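/- **Theorem 3.14 (Conservation of the total mass of individuals).** Let $\varepsilon>0$ and let $\mathbf C:\mathbb R^2\to\mathbb R^2$ be bounded, uniformly continuous and of class $C^1$, with bounded and uniformly continuous partial derivatives $\partial_{x_1}\mathbf C,\ \partial_{x_2}\mathbf C$. Let $L^1=L^1(\mathbb R^2;\mathbb R)$, and for $u\in L^1$ and $t\ge 0$ put - $T_A(0)u=u$ and $\displaystyle (T_A(t)u)(x)=\int_{\mathbb R^2}\frac{1}{4\pi\varepsilon^2t}\,e^{-\frac{|x-z|^2}{4\varepsilon^2t}}\,u(z)\,dz$ for $t>0$; - $\displaystyle (T_B(t)u)(x)=\exp\Bigl(-\int_0^t(\nabla\cdot\mathbf C)(\Pi(-\sigma)x)\,d\sigma\Bigr)\,u(\Pi(-t)x)$, where $\Pi$ is the flow of $\mathbf C$: $\partial_t\Pi(t)z=\mathbf C(\Pi(t)z)$ for $t\in\mathbb R$, $\Pi(0)z=z$. Let $A$ and $B$ be their infinitesimal generators in $L^1$: $Au=\lim_{t\searrow0}t^{-1}(T_A(t)u-u)$ with domain $D(A)$ the set of $u\in L^1$ for which this limit exists in $L^1$, and likewise $B$ for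 $T_B$. (These are the realizations in $L^1$ of $u\mapsto\varepsilon^2\Delta u$ and $u\mapsto-\nabla\cdot(u\,\mathbf C)$.) Then $D(A)\subset D(B)$, and the operator $A+B$ with domain $D(A)$ is the infinitesimal generator of a strongly continuous semigroup $\{T_{A+B}(t)\}_{t\ge0}$ of bounded linear operators on $L^1$ such that for every $v_0\in L^1$ with $v_0\ge0$: 1. $v(t)=T_{A+B}(t)v_0$ is the unique mild solution of the convection–diffusion problem $$v'(t)=(A+B)v(t)\ (t\ge0),\qquad v(0)=v_0,$$ that is, the unique continuous map $v:[0,\infty)\to L^1$ with $\int_0^tv(s)\,ds\in D(A)$ and $v(t)=v_0+(A+B)\int_0^tv(s)\,ds$ for all $t\ge0$; 2. the total mass is conserved: $$\int_{\mathbb R^2}v(t,x)\,dx=\int_{\mathbb R^2}v_0(x)\,dx\qquad\text{for all }t\ge0.$$ -/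

import Mathlib

open MeasureTheory Filter Topology
open scoped NNReal

noncomputable section

namespace ConvectionDiffusion

/-- The plane `ℝ²` with its Euclidean norm and Lebesgue measure. -/
abbrev Plane : Type := EuclideanSpace ℝ (Fin 2)

/-- The real Banach lattice `L¹(ℝ²)`. -/
abbrev L1 : Type := Lp ℝ 1 (volume : Measure Plane)

/-- The class in `L¹(ℝ²)` of an integrable function (and `0` for a function that is not integrable;
this case does not occur for the two families of operators below). -/
def toL1 (f : Plane → ℝ) : L1 :=
  open Classical in if h : Integrable f volume then h.toL1 f else 0

/-! ### Semigroups and generators -/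

section Abstract

variable {X : Type*} [NormedAddCommGroup X] [NormedSpace ℝ X]

/-- Strongly continuous semigroups of bounded linear operators. -/
structure IsC0Semigroup (T : ℝ≥0 → X →L[ℝ] X) : Prop where
  zero : T 0 = ContinuousLinearMap.id ℝ X
  add : ∀ s t : ℝ≥0, T (s + t) = (T s).comp (T t)
  continuous : ∀ u : X, Continuous fun t : ℝ≥0 => T t u

/-- The infinitesimal generator of a family of operators, given by its graph: `(u, w)` belongs to it
when `(T(t) u - u) / t` tends to `w` as `t` decreases to `0`. -/
def generator (T : ℝ≥0 → X → X) : Set (X × X) :=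
  {p | Tendsto (fun t : ℝ≥0 => (t : ℝ)⁻¹ • (T t p.1 - p.1)) (𝓝[>] 0) (𝓝 p.2)}

/-- The domain of an operator given by its graph. -/
def domain (G : Set (X × X)) : Set X := {u | ∃ w, (u, w) ∈ G}

/-- The sum of two operators given by their graphs: `u ↦ A u + B u` on `D(A) ∩ D(B)`. -/
def opSum (A B : Set (X × X)) : Set (X × X) :=
  {p | ∃ a b : X, (p.1, a) ∈ A ∧ (p.1, b) ∈ B ∧ p.2 = a + b}

/-- Mild solutions of `v' = G v`, `v(0) = v₀`: continuous maps `v : [0, ∞) → X` such that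
`∫₀ᵗ v(s) ds ∈ D(G)` and `v(t) = v₀ + G ∫₀ᵗ v(s) ds` for all `t ≥ 0`. -/
def IsMildSolution (G : Set (X × X)) (v₀ : X) (v : ℝ≥0 → X) : Prop :=
  Continuous v ∧
    ∀ t : ℝ≥0, ((∫ s in (0 : ℝ)..(t : ℝ), v s.toNNReal), v t - v₀) ∈ G

end Abstract

/-! ### Diffusion -/

/-- The heat kernel `K(t, x) = (4 π ε² t)⁻¹ exp(-|x|² / (4 ε² t))`. -/
def heatKernel (ε t : ℝ) (x : Plane) : ℝ :=
  1 / (4 * Real.pi * ε ^ 2 * t) * Real.exp (-‖x‖ ^ 2 / (4 * ε ^ 2 * t))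

/-- The semigroup of `ε² Δ` on `L¹(ℝ²)`: convolution with the heat kernel for `t > 0`, the identity
for `t = 0`. -/
def heatSemigroup (ε : ℝ) (t : ℝ≥0) (u : L1) : L1 :=
  if t = 0 then u else toL1 fun x => ∫ z, heatKernel ε t (x - z) * u z

/-- The diffusion operator `A`, that is the generator of the heat semigroup. -/
def diffusionOp (ε : ℝ) : Set (L1 × L1) := generator (heatSemigroup ε)

/-! ### Convection -/

/-- The `i`-th partial derivative `∂_{x_i} C`. -/
def partialDeriv (C : Plane → Plane) (i : Fin 2) (x : Plane) : Plane :=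
  fderiv ℝ C x (EuclideanSpace.single i 1)

/-- The hypotheses on the speed: bounded, uniformly continuous, of class `C¹`, with bounded and
uniformly continuous partial derivatives. -/
structure IsAdmissibleSpeed (C : Plane → Plane) : Prop where
  uniformContinuous : UniformContinuous C
  bounded : ∃ M : ℝ, ∀ x, ‖C x‖ ≤ M
  contDiff : ContDiff ℝ 1 C
  partial_uniformContinuous : ∀ i, UniformContinuous (partialDeriv C i)
  partial_bounded : ∀ i, ∃ M : ℝ, ∀ x, ‖partialDeriv C i x‖ ≤ M

/-- The divergence `∇ · C = ∂₁ C₁ + ∂₂ C₂`. -/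
def divergence (C : Plane → Plane) (x : Plane) : ℝ := ∑ i, partialDeriv C i x i

/-- `γ` is a global integral curve of `C` starting at `z`. -/
def IsTrajectory (C : Plane → Plane) (z : Plane) (γ : ℝ → Plane) : Prop :=
  γ 0 = z ∧ ∀ t : ℝ, HasDerivAt γ (C (γ t)) t

/-- The flow of `C`: `t ↦ flow C t z` is the solution on `ℝ` of `γ' = C(γ)`, `γ(0) = z`. For an
admissible speed it exists and is unique, so the default value is never used. -/
def flow (C : Plane → Plane) (t : ℝ) (z : Plane) : Plane :=
  open Classical in if h : ∃ γ : ℝ → Plane, IsTrajectory C z γ then h.choose t else z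

/-- The semigroup on `L¹(ℝ²)` of the transport equation `∂ₜ v = -∇ · (v C)`, integrated along the
characteristics:
`(T(t) v)(x) = exp(-∫₀ᵗ (∇ · C)(Π(-σ) x) dσ) v(Π(-t) x)`, where `Π` is the flow of `C`. -/
def transportSemigroup (C : Plane → Plane) (t : ℝ≥0) (u : L1) : L1 :=
  toL1 fun x =>
    Real.exp (-∫ σ in (0 : ℝ)..(t : ℝ), divergence C (flow C (-σ) x)) * u (flow C (-(t : ℝ)) x)

/-- The convection operator `B`, that is the generator of the transport semigroup. -/
def convectionOp (C : Plane → Plane) : Set (L1 × L1) := generator (transportSemigroup C)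

end ConvectionDiffusion

end

/-! Write A for the diffusion and B for the convection. The argument perturbs the generator of a
contraction semigroup by a quasi-dissipative operator that is small relative to it.

The heat semigroup is an average of translations, hence a mass-preserving contraction of L¹. The
transport semigroup has norm at most exp((D + 2K)t), where D bounds |∇·C| and K is a Lipschitz
constant of C. Such growth bounds make a generator quasi-dissipative with respect to every norming
functional (`generator_apply_le`), a property stable under sums (`IsQuasiDissipative.opSum`). So A +
B is quasi-dissipative.

There remains the range condition. As l - A - B = (1 - B(l - A)⁻¹)(l - A), it suffices that B(l -
A)⁻¹ have norm at most 1/2 for large l. Convection costs one derivative of the heat kernel, hence a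
factor of order 1/√t: B T_A(t) is bounded by a + b/√t, whose Laplace transform tends to 0 as l → ∞.
The difference quotients of T_B satisfy the same bound uniformly in the step
(`IsBoundedSpeed.norm_quotient_heatKernelAt_le`), and dominated convergence then yields at once D(A)
⊂ D(B) and the relative bound (`IsBoundedSpeed.isHalfBounded`). The Hille–Yosida theorem, proved by
Yosida approximation, produces the semigroup.

Uniqueness: the time integral W of the difference of two mild solutions solves W' = (A + B)W, W(0) =
0, and quasi-dissipativity forces W = 0. Mass: the mass functional kills the range of A because T_A
preserves it, and kills B(l - A)⁻¹f because ∫ ∇·(kC) = 0 for every heat kernel k; hence it kills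
v(t) - v₀ = (A + B)∫₀ᵗ v. -/

noncomputable section

namespace ConvectionDiffusion

/-! ### Generators, orbits and Laplace transforms of semigroups. -/

section Semigroups

variable {X : Type*} [NormedAddCommGroup X] [NormedSpace ℝ X]

lemma tendsto_coe_nhdsGT_zero :
    Tendsto (fun t : ℝ≥0 => (t : ℝ)) (𝓝[>] 0) (𝓝[>] 0) := by
  refine tendsto_nhdsWithin_iff.2 ⟨?_, ?_⟩
  · exact (NNReal.continuous_coe.tendsto' 0 0 rfl).mono_left nhdsWithin_le_nhds
  · filter_upwards [self_mem_nhdsWithin] with t ht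
    exact NNReal.coe_pos.2 ht

lemma tendsto_coe_nhdsNE_zero :
    Tendsto (fun t : ℝ≥0 => (t : ℝ)) (𝓝[>] 0) (𝓝[≠] 0) :=
  tendsto_coe_nhdsGT_zero.mono_right
    (nhdsWithin_mono 0 fun _ (hx : (0 : ℝ) < _) => hx.ne')

lemma tendsto_slope_nnreal {f : ℝ → X} {f' : X} {x : ℝ} (hf : HasDerivAt f f' x) :
    Tendsto (fun t : ℝ≥0 => (t : ℝ)⁻¹ • (f (x + t) - f x)) (𝓝[>] 0) (𝓝 f') :=
  (hasDerivAt_iff_tendsto_slope_zero.1 hf).comp tendsto_coe_nhdsNE_zero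

lemma tendsto_exp_slope_nnreal (ω : ℝ) :
    Tendsto (fun t : ℝ≥0 => (t : ℝ)⁻¹ * (Real.exp (ω * t) - 1)) (𝓝[>] 0) (𝓝 ω) := by
  have h : HasDerivAt (fun t : ℝ => Real.exp (ω * t)) ω 0 := by
    simpa using ((hasDerivAt_id (0 : ℝ)).const_mul ω).exp
  simpa using tendsto_slope_nnreal h

/-- The generator of a family of bounded operators, as a linear relation. -/
def generatorSubmodule (T : ℝ≥0 → X →L[ℝ] X) : Submodule ℝ (X × X) where
  carrier := generator fun t u => T t u
  add_mem' := by
    intro p q hp hq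
    refine (Tendsto.add hp hq).congr fun t => ?_
    simp only [Prod.fst_add, map_add, ← smul_add]
    congr 1
    abel
  zero_mem' := by
    simp [generator]
  smul_mem' := by
    intro c p hp
    refine (Tendsto.const_smul hp c).congr fun t => ?_
    simp only [Prod.smul_fst, map_smul, ← smul_sub, smul_comm c]

lemma mem_generatorSubmodule {T : ℝ≥0 → X →L[ℝ] X} {p : X × X} :
    p ∈ generatorSubmodule T ↔ p ∈ generator fun t u => T t u := Iff.rfl

lemma generator_unique {T : ℝ≥0 → X → X} {u w w' : X} (h : (u, w) ∈ generator T)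
    (h' : (u, w') ∈ generator T) : w = w' :=
  tendsto_nhds_unique (f := fun t : ℝ≥0 => (t : ℝ)⁻¹ • (T t u - u)) h h'

/-- A generator is quasi-dissipative with respect to every norming functional. -/
lemma generator_apply_le {T : ℝ≥0 → X → X} {ω : ℝ} {u w : X}
    (hT : ∀ t : ℝ≥0, ‖T t u‖ ≤ Real.exp (ω * t) * ‖u‖) (h : (u, w) ∈ generator T)
    {φ : StrongDual ℝ X} (hφ : ‖φ‖ ≤ 1) (hu : φ u = ‖u‖) : φ w ≤ ω * ‖u‖ := by
  have h1 : Tendsto (fun t : ℝ≥0 => φ ((t : ℝ)⁻¹ • (T t u - u))) (𝓝[>] 0) (𝓝 (φ w)) :=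
    (φ.continuous.tendsto w).comp h
  have h2 := (tendsto_exp_slope_nnreal ω).mul_const ‖u‖
  refine le_of_tendsto_of_tendsto' h1 h2 fun t => ?_
  rw [map_smul, map_sub, hu, smul_eq_mul, mul_assoc]
  -- The orbit seen through φ starts at ‖u‖ and stays below exp(ωt)‖u‖, so its slope at 0 is at most
  -- that of the exponential.
  have h3 : φ (T t u) ≤ Real.exp (ω * t) * ‖u‖ :=
    (le_abs_self _).trans ((φ.le_of_opNorm_le hφ _).trans (by simpa using hT t))
  have : φ (T t u) - ‖u‖ ≤ (Real.exp (ω * t) - 1) * ‖u‖ := by linarith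
  exact mul_le_mul_of_nonneg_left this (by positivity)

/-- An invariant functional vanishes on the range of the generator. -/
lemma generator_apply_eq_zero {T : ℝ≥0 → X → X} {u w : X} (m : StrongDual ℝ X)
    (hT : ∀ t : ℝ≥0, m (T t u) = m u) (h : (u, w) ∈ generator T) : m w = 0 := by
  have h1 : Tendsto (fun t : ℝ≥0 => m ((t : ℝ)⁻¹ • (T t u - u))) (𝓝[>] 0) (𝓝 (m w)) :=
    (m.continuous.tendsto w).comp h
  refine tendsto_nhds_unique h1 (tendsto_const_nhds.congr fun t => ?_)
  rw [map_smul, map_sub, hT, sub_self, smul_zero]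

namespace IsC0Semigroup

variable {T : ℝ≥0 → X →L[ℝ] X}

lemma continuous_orbit (hT : IsC0Semigroup T) (u : X) :
    Continuous fun s : ℝ => T s.toNNReal u :=
  (hT.continuous u).comp continuous_real_toNNReal

/-- The resolvent of the generator of a contraction semigroup, as a Laplace transform. -/
def laplace (T : ℝ≥0 → X →L[ℝ] X) (l : ℝ) (f : X) : X :=
  ∫ s in Set.Ioi (0 : ℝ), Real.exp (-(l * s)) • T s.toNNReal f

lemma integrableOn_laplace (hT : IsC0Semigroup T) (hc : ∀ t u, ‖T t u‖ ≤ ‖u‖) {l : ℝ}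
    (hl : 0 < l) (f : X) :
    IntegrableOn (fun s : ℝ => Real.exp (-(l * s)) • T s.toNNReal f) (Set.Ioi 0) := by
  have h1 : IntegrableOn (fun s : ℝ => Real.exp (-l * s) * ‖f‖) (Set.Ioi 0) :=
    (exp_neg_integrableOn_Ioi 0 hl).mul_const _
  refine Integrable.mono' h1 ?_ (Eventually.of_forall fun s => ?_)
  · exact ((by fun_prop : Continuous fun s : ℝ => Real.exp (-(l * s))).smul
      (hT.continuous_orbit f)).aestronglyMeasurable
  · rw [norm_smul, Real.norm_eq_abs, Real.abs_exp, neg_mul]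
    exact mul_le_mul_of_nonneg_left (hc _ _) (Real.exp_pos _).le

variable [CompleteSpace X]

/-- The time integral of an orbit lies in the domain of the generator. -/
lemma integral_mem_generator (hT : IsC0Semigroup T) (t : ℝ≥0) (u : X) :
    ((∫ s in (0 : ℝ)..t, T s.toNNReal u), T t u - u) ∈ generator fun t u => T t u := by
  have hg := hT.continuous_orbit u
  set g : ℝ → X := fun s => T s.toNNReal u with hgdef
  set F : ℝ → X := fun r => ∫ s in (0 : ℝ)..r, g s with hF
  have hint : ∀ a b, IntervalIntegrable g volume a b := fun a b => hg.intervalIntegrable a b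
  have hd : ∀ r, HasDerivAt F (g r) r := fun r => hg.integral_hasStrictDerivAt 0 r |>.hasDerivAt
  -- Applying T h shifts the window of integration from [0, t] to [h, t + h], so the integral
  -- changes only at its two ends.
  have key : ∀ h : ℝ≥0, T h (F t) - F t = (F (t + h) - F t) - (F (0 + h) - F 0) := by
    intro h
    have h1 : T h (F t) = ∫ s in (0 : ℝ)..t, g (s + h) := by
      rw [hF, ← ContinuousLinearMap.intervalIntegral_comp_comm _ (hint _ _)]
      refine intervalIntegral.integral_congr fun s hs => ?_
      rw [Set.uIcc_of_le t.coe_nonneg] at hs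
      simp only [hgdef]
      rw [Real.toNNReal_add hs.1 h.coe_nonneg, Real.toNNReal_coe, add_comm, hT.add]
      rfl
    have h2 : T h (F t) = F (t + h) - F h := by
      rw [h1, intervalIntegral.integral_comp_add_right, hF]
      simp only [zero_add]
      rw [intervalIntegral.integral_interval_sub_left (hint _ _) (hint _ _)]
    have h0 : F 0 = 0 := by simp [hF]
    rw [h2, h0, zero_add]
    abel
  have hlim := (tendsto_slope_nnreal (hd t)).sub (tendsto_slope_nnreal (hd 0))
  have e1 : g t = T t u := by simp [hgdef]
  have e2 : g 0 = u := by simp [hgdef, hT.zero]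
  rw [e1, e2] at hlim
  refine hlim.congr fun h => ?_
  rw [← smul_sub, ← key]

/-- The averages h⁻¹∫₀ʰ T(s)u ds lie in the domain and converge to u. -/
lemma dense_domain_generator (hT : IsC0Semigroup T) :
    Dense (domain (generator fun t u => T t u)) := by
  intro u
  have hg := hT.continuous_orbit u
  have hd := tendsto_slope_nnreal (hg.integral_hasStrictDerivAt 0 0).hasDerivAt
  have e2 : T (0 : ℝ).toNNReal u = u := by simp [hT.zero]
  rw [e2] at hd
  refine mem_closure_of_tendsto hd (Eventually.of_forall fun h => ?_)
  have := (generatorSubmodule T).smul_mem (h : ℝ)⁻¹ (hT.integral_mem_generator h u)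
  refine ⟨(h : ℝ)⁻¹ • (T h u - u), ?_⟩
  rw [zero_add, intervalIntegral.integral_same, sub_zero]
  exact this

/-- A shift of variable gives T(h)R = exp(lh)(R - ∫₀ʰ g), where g is the integrand defining R; the
right derivative at h = 0 is lR - f. -/
lemma laplace_mem_generator (hT : IsC0Semigroup T) (hc : ∀ t u, ‖T t u‖ ≤ ‖u‖) {l : ℝ}
    (hl : 0 < l) (f : X) :
    (laplace T l f, l • laplace T l f - f) ∈ generator fun t u => T t u := by
  have hi := hT.integrableOn_laplace hc hl f
  have hg : Continuous fun s : ℝ => Real.exp (-(l * s)) • T s.toNNReal f :=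
    (by fun_prop : Continuous fun s : ℝ => Real.exp (-(l * s))).smul (hT.continuous_orbit f)
  set g : ℝ → X := fun s => Real.exp (-(l * s)) • T s.toNNReal f with hgdef
  set R := laplace T l f with hR
  have hd : HasDerivAt (fun r => ∫ s in (0 : ℝ)..r, g s) (g 0) 0 :=
    (hg.integral_hasStrictDerivAt 0 0).hasDerivAt
  have key : ∀ h : ℝ≥0, T h R = Real.exp (l * h) • (R - ∫ s in (0 : ℝ)..h, g s) := by
    intro h
    have h1 : T h R = ∫ s in Set.Ioi (0 : ℝ), Real.exp (l * h) • g (s + h) := by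
      rw [hR, laplace, ← ContinuousLinearMap.integral_comp_comm _ hi]
      refine setIntegral_congr_fun measurableSet_Ioi fun s (hs : 0 < s) => ?_
      simp only [hgdef, map_smul]
      rw [Real.toNNReal_add hs.le h.coe_nonneg, Real.toNNReal_coe, add_comm s.toNNReal, hT.add,
        smul_smul, ← Real.exp_add]
      congr 2
      ring
    have h2 : ∫ s in Set.Ioi (0 : ℝ), g (s + h) = ∫ s in Set.Ioi (h : ℝ), g s := by
      have := (measurePreserving_add_right volume (h : ℝ)).setIntegral_preimage_emb
        (measurableEmbedding_addRight (h : ℝ)) g (Set.Ioi (h : ℝ))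
      rwa [Set.preimage_add_const_Ioi, sub_self] at this
    rw [h1, integral_smul, h2]
    congr 1
    rw [eq_sub_iff_add_eq, add_comm, hR]
    exact intervalIntegral.integral_interval_add_Ioi hi
      (hi.mono_set (Set.Ioi_subset_Ioi h.coe_nonneg))
  have hexp : Tendsto (fun h : ℝ≥0 => Real.exp (l * h)) (𝓝[>] 0) (𝓝 1) := by
    have : Continuous fun h : ℝ≥0 => Real.exp (l * h) := by fun_prop
    exact (this.tendsto' 0 1 (by simp)).mono_left nhdsWithin_le_nhds
  have hlim := ((tendsto_exp_slope_nnreal l).smul_const R).sub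
    (hexp.smul (tendsto_slope_nnreal hd))
  have e2 : g 0 = f := by simp [hgdef, hT.zero]
  rw [e2, one_smul] at hlim
  refine hlim.congr fun h => ?_
  simp only [key, intervalIntegral.integral_same, sub_zero, zero_add]
  module

/-- Orbits of a strongly continuous semigroup are mild solutions. -/
lemma isMildSolution (hT : IsC0Semigroup T) (u : X) :
    IsMildSolution (generator fun t u => T t u) u fun t => T t u :=
  ⟨hT.continuous u, fun t => hT.integral_mem_generator t u⟩

end IsC0Semigroup
end Semigroups

/-! ### Dissipative relations, their resolvents and Yosida approximations. -/

section HilleYosida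

variable {X : Type*} [NormedAddCommGroup X] [NormedSpace ℝ X]

/-- Dissipativity of a linear relation. -/
def IsDissipative (G : Submodule ℝ (X × X)) : Prop :=
  ∀ p ∈ G, ∀ h : ℝ, 0 < h → ‖p.1‖ ≤ ‖p.1 - h • p.2‖

/-- Quasi-dissipativity of a linear relation with respect to all norming functionals. -/
def IsQuasiDissipative (ω : ℝ) (G : Set (X × X)) : Prop :=
  ∀ p ∈ G, ∀ φ : StrongDual ℝ X, ‖φ‖ ≤ 1 → φ p.1 = ‖p.1‖ → φ p.2 ≤ ω * ‖p.1‖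

/-- Hahn–Banach provides a norming functional φ of u; then ‖u‖ = φ(u) ≤ φ(u - hw) because φ(w) ≤ 0.
-/
lemma IsQuasiDissipative.isDissipative {G : Submodule ℝ (X × X)}
    (hG : IsQuasiDissipative 0 (G : Set (X × X))) : IsDissipative G := by
  intro p hp h hh
  obtain ⟨φ, hφ, hu⟩ := exists_dual_vector'' ℝ p.1
  have hw := hG p hp φ hφ hu
  have h1 : φ (p.1 - h • p.2) ≤ ‖p.1 - h • p.2‖ :=
    (le_abs_self _).trans ((φ.le_of_opNorm_le hφ _).trans (one_mul _).le)
  rw [map_sub, map_smul, smul_eq_mul, hu] at h1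
  simp only [RCLike.ofReal_real_eq_id, id_eq] at h1
  nlinarith

/-- Maximality of a dissipative relation with full range: 1 - hG' is injective, while 1 - hG already
reaches everything, so a pair of G' must coincide with the pair of G having the same image. -/
lemma IsDissipative.eq_of_le {G G' : Submodule ℝ (X × X)} (hG' : IsDissipative G') (hle : G ≤ G')
    {h : ℝ} (hh : 0 < h) (hR : ∀ f : X, ∃ p ∈ G, p.1 - h • p.2 = f) : G' = G := by
  refine le_antisymm (fun p hp => ?_) hle
  obtain ⟨q, hq, hqp⟩ := hR (p.1 - h • p.2)
  have h1 := hG' _ (G'.sub_mem hp (hle hq)) h hh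
  have h2 : (p - q).1 - h • (p - q).2 = 0 := by
    rw [Prod.fst_sub, Prod.snd_sub, smul_sub, sub_sub_sub_comm, hqp, sub_self]
  rw [h2, norm_zero, norm_le_zero_iff] at h1
  rw [h1, zero_sub, neg_eq_zero, smul_eq_zero_iff_right hh.ne'] at h2
  have : p = q := sub_eq_zero.1 (Prod.ext h1 h2)
  rwa [this]

/-- Dissipativity makes preimages under 1 - hG unique. Uniqueness makes the choice of preimage
linear, and the dissipative inequality makes it a contraction. -/
lemma IsDissipative.exists_resolvent {G : Submodule ℝ (X × X)} (hG : IsDissipative G) {h : ℝ}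
    (hh : 0 < h) (hR : ∀ f : X, ∃ p ∈ G, p.1 - h • p.2 = f) :
    ∃ J : X →L[ℝ] X, (∀ f, ‖J f‖ ≤ ‖f‖) ∧ (∀ f, (J f, h⁻¹ • (J f - f)) ∈ G) ∧
      ∀ p ∈ G, J (p.1 - h • p.2) = p.1 := by
  choose r hrG hr using hR
  have huniq : ∀ p ∈ G, (r (p.1 - h • p.2)).1 = p.1 := by
    intro p hp
    have h1 := hG _ (G.sub_mem (hrG (p.1 - h • p.2)) hp) h hh
    rw [Prod.fst_sub, Prod.snd_sub, smul_sub, sub_sub_sub_comm, hr, sub_self, norm_zero,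
      norm_le_zero_iff] at h1
    exact sub_eq_zero.1 h1
  let J : X →ₗ[ℝ] X :=
    { toFun := fun f => (r f).1
      map_add' := fun f g => by
        have := huniq _ (G.add_mem (hrG f) (hrG g))
        rwa [Prod.fst_add, Prod.snd_add, smul_add, add_sub_add_comm, hr, hr] at this
      map_smul' := fun c f => by
        have := huniq _ (G.smul_mem c (hrG f))
        rwa [Prod.smul_fst, Prod.smul_snd, smul_comm h c, ← smul_sub, hr] at this }
  have hJ : ∀ f, ‖J f‖ ≤ 1 * ‖f‖ := by
    intro f
    have := hG _ (hrG f) h hh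
    rwa [hr, ← one_mul ‖f‖] at this
  refine ⟨J.mkContinuous 1 hJ, fun f => by simpa using hJ f, fun f => ?_, huniq⟩
  have h2 : (r f).2 = h⁻¹ • ((r f).1 - f) := by
    rw [eq_inv_smul_iff₀ hh.ne']
    nth_rewrite 3 [← hr f]
    abel
  have h3 := hrG f
  rw [← Prod.mk.eta (p := r f), h2] at h3
  exact h3

lemma resolvent_comm {G : Submodule ℝ (X × X)} {a b : ℝ} (ha : 0 < a) (hb : 0 < b)
    {J K : X →L[ℝ] X} (hJ : ∀ f, (J f, a⁻¹ • (J f - f)) ∈ G)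
    (hJ' : ∀ p ∈ G, J (p.1 - a • p.2) = p.1) (hK : ∀ f, (K f, b⁻¹ • (K f - f)) ∈ G)
    (hK' : ∀ p ∈ G, K (p.1 - b • p.2) = p.1) : Commute J K := by
  ext f
  set u := J f with hu
  set v := K u with hv
  have hvG := hK u
  rw [← hv] at hvG
  have huG := hJ f
  rw [← hu] at huG
  have h1 := hJ' _ hvG
  -- This combination of two pairs of G is the one that 1 - bG sends to f (the resolvent identity).
  -- It gives K f = v - aGv, which J sends back to v = K(J f).
  have h2 := hK' _ (G.add_mem (G.smul_mem (1 - a / b) hvG) (G.smul_mem (a / b) huG))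
  have h3 : K f = v - a • b⁻¹ • (v - u) := by
    rw [show f = _ from ?_, h2]
    · simp only [Prod.fst_add, Prod.smul_fst]
      match_scalars <;> field_simp
    · simp only [Prod.fst_add, Prod.smul_fst, Prod.snd_add, Prod.smul_snd]
      match_scalars <;> field_simp <;> ring
  change J (K f) = K (J f)
  rw [h3]
  exact h1

section Limits

variable [CompleteSpace X]

/-- Contractions are equicontinuous, so pointwise convergence spreads from a dense set to the whole
space by an ε/3 argument. -/
lemma exists_limit_of_contractions {E : ℕ → X →L[ℝ] X} (hE : ∀ n u, ‖E n u‖ ≤ ‖u‖) {D : Set X}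
    (hD : Dense D) (hc : ∀ u ∈ D, CauchySeq fun n => E n u) :
    ∃ L : X →L[ℝ] X, (∀ u, ‖L u‖ ≤ ‖u‖) ∧ ∀ u, Tendsto (fun n => E n u) atTop (𝓝 (L u)) := by
  have hall : ∀ u, ∃ y, Tendsto (fun n => E n u) atTop (𝓝 y) := by
    intro u
    refine cauchySeq_tendsto_of_complete (Metric.cauchySeq_iff.2 fun ε hε => ?_)
    obtain ⟨w, hw, hwD⟩ := Metric.dense_iff.1 hD u (ε / 3) (by positivity)
    obtain ⟨N, hN⟩ := Metric.cauchySeq_iff.1 (hc w hwD) (ε / 3) (by positivity)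
    refine ⟨N, fun m hm n hn => ?_⟩
    have h1 : ∀ k, dist (E k u) (E k w) < ε / 3 := fun k => by
      rw [dist_eq_norm, ← map_sub]
      refine (hE k _).trans_lt ?_
      rwa [← dist_eq_norm, dist_comm]
    calc dist (E m u) (E n u) ≤ dist (E m u) (E m w) + dist (E m w) (E n w)
          + dist (E n w) (E n u) := dist_triangle4 _ _ _ _
      _ < ε / 3 + ε / 3 + ε / 3 := by
          have h2 := h1 n
          rw [dist_comm] at h2
          exact add_lt_add (add_lt_add (h1 m) (hN m hm n hn)) h2
      _ = ε := by ring
  choose L hL using hall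
  have hLn : ∀ u, ‖L u‖ ≤ 1 * ‖u‖ := fun u =>
    le_of_tendsto (hL u).norm (Eventually.of_forall fun n => by simpa using hE n u)
  let L' : X →ₗ[ℝ] X :=
    { toFun := L
      map_add' := fun u v => tendsto_nhds_unique (hL (u + v))
        (((hL u).add (hL v)).congr fun n => (map_add (E n) u v).symm)
      map_smul' := fun c u => tendsto_nhds_unique (hL (c • u))
        (((hL u).const_smul c).congr fun n => (map_smul (E n) c u).symm) }
  exact ⟨L'.mkContinuous 1 hLn, fun u => (hLn u).trans_eq (one_mul _), hL⟩

lemma tendsto_id_of_contractions {E : ℕ → X →L[ℝ] X} (hE : ∀ n u, ‖E n u‖ ≤ ‖u‖) {D : Set X}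
    (hD : Dense D) (hc : ∀ u ∈ D, Tendsto (fun n => E n u) atTop (𝓝 u)) (u : X) :
    Tendsto (fun n => E n u) atTop (𝓝 u) := by
  obtain ⟨L, -, hL⟩ := exists_limit_of_contractions hE hD fun u hu => (hc u hu).cauchySeq
  have : (L : X → X) = id := L.continuous.ext_on hD continuous_id fun u hu =>
    tendsto_nhds_unique (hL u) (hc u hu)
  have h1 := hL u
  rwa [this] at h1

open NormedSpace in
-- Interpolate by s ↦ exp(sa)exp((t - s)b)u: since a and b commute, its derivative is exp(sa)exp((t
-- - s)b)(a - b)u, of norm at most ‖au - bu‖.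
lemma norm_exp_sub_exp_le {a b : X →L[ℝ] X} (hab : Commute a b)
    (ha : ∀ t : ℝ, 0 ≤ t → ∀ u, ‖exp (t • a) u‖ ≤ ‖u‖)
    (hb : ∀ t : ℝ, 0 ≤ t → ∀ u, ‖exp (t • b) u‖ ≤ ‖u‖) {t : ℝ} (ht : 0 ≤ t) (u : X) :
    ‖exp (t • a) u - exp (t • b) u‖ ≤ t * ‖a u - b u‖ := by
  have hd : ∀ s : ℝ, HasDerivAt (fun s : ℝ => (exp (s • a) * exp ((t - s) • b)) u)
      (exp (s • a) (exp ((t - s) • b) (a u - b u))) s := by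
    intro s
    have h1 := hasDerivAt_exp_smul_const (𝕂 := ℝ) a s
    have h2 := (hasDerivAt_exp_smul_const (𝕂 := ℝ) b (t - s)).scomp s
      ((hasDerivAt_id s).const_sub t)
    have h3 := (h1.mul h2).clm_apply (hasDerivAt_const s u)
    convert! h3 using 1
    have hc : exp ((t - s) • b) * a = a * exp ((t - s) • b) :=
      (((hab.symm).smul_left (t - s)).exp_left).eq
    have hc' := fun x => DFunLike.congr_fun hc x
    simp only [mul_apply_eq_comp] at hc'
    simp only [map_sub, hc']
    simp [sub_eq_add_neg]
  have h4 := norm_image_sub_le_of_norm_deriv_le_segment' (a := 0) (b := t)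
    (C := ‖a u - b u‖) (fun s _ => (hd s).hasDerivWithinAt)
    (fun s hs => (ha s hs.1 _).trans (hb (t - s) (by linarith [hs.2]) _)) t ⟨ht, le_rfl⟩
  simpa [mul_comm] using h4

open NormedSpace in
-- With c = t/h the operator is exp(-c)·exp(cJ), and the power series bounds exp(cJ) by exp(c)
-- because every power of J is a contraction.
lemma norm_exp_yosida_le {J : X →L[ℝ] X} (hJ : ∀ u, ‖J u‖ ≤ ‖u‖) {h : ℝ} (hh : 0 < h) {t : ℝ}
    (ht : 0 ≤ t) (u : X) : ‖exp (t • h⁻¹ • (J - 1)) u‖ ≤ ‖u‖ := by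
  let _ := NormedAlgebra.restrictScalars ℚ ℝ (X →L[ℝ] X)
  have hc : 0 ≤ t * h⁻¹ := by positivity
  rw [smul_smul]
  set c := t * h⁻¹
  have h1 : c • (J - 1) = c • J + algebraMap ℝ (X →L[ℝ] X) (-c) := by
    rw [Algebra.algebraMap_eq_smul_one, smul_sub, neg_smul, sub_eq_add_neg]
  rw [h1, exp_add_of_commute (Algebra.commutes (-c) (c • J)).symm, ← algebraMap_exp_comm,
    ← Real.exp_eq_exp_ℝ, Algebra.algebraMap_eq_smul_one]
  have hpow : ∀ (n : ℕ) v, ‖(J ^ n) v‖ ≤ ‖v‖ := by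
    intro n
    induction n with
    | zero => simp
    | succ n ih =>
      intro v
      rw [pow_succ']
      exact (hJ _).trans (ih v)
  have hs := exp_series_hasSum_exp' (𝕂 := ℝ) (c • J)
  have hs' := hs.mapL (ContinuousLinearMap.apply ℝ X (Real.exp (-c) • u))
  have hr := (exp_series_hasSum_exp' (𝕂 := ℝ) c).mul_right ‖Real.exp (-c) • u‖
  have h2 := hs'.norm_le_of_bounded hr fun n => by
    simp only [ContinuousLinearMap.apply_apply, smul_pow, smul_apply,
      norm_smul, smul_eq_mul, norm_inv, norm_pow, Real.norm_eq_abs, abs_of_nonneg hc,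
      RCLike.norm_natCast, mul_assoc, Real.abs_exp, map_smul]
    have := hpow n u
    gcongr
  rw [← Real.exp_eq_exp_ℝ, norm_smul, Real.norm_eq_abs, Real.abs_exp, ← mul_assoc, ← Real.exp_add,
    add_neg_cancel, Real.exp_zero, one_mul] at h2
  simpa using h2

end Limits

end HilleYosida

/-! ### Generation theorems and uniqueness of mild solutions. -/

section HilleYosida

variable {X : Type*} [NormedAddCommGroup X] [NormedSpace ℝ X]

lemma generator_isDissipative {T : ℝ≥0 → X →L[ℝ] X} (hc : ∀ t u, ‖T t u‖ ≤ ‖u‖) :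
    IsDissipative (generatorSubmodule T) :=
  IsQuasiDissipative.isDissipative fun _ hp _ hφ hu =>
    generator_apply_le (fun t => by simpa using hc t _) hp hφ hu

/-- **Hille–Yosida theorem**: a densely defined dissipative operator satisfying the range
condition generates a strongly continuous contraction semigroup. -/
theorem exists_semigroup_of_isDissipative [CompleteSpace X] {G : Submodule ℝ (X × X)}
    (hG : IsDissipative G) (hD : Dense (domain (G : Set (X × X)))) {δ : ℝ} (hδ : 0 < δ)
    (hR : ∀ h, 0 < h → h < δ → ∀ f : X, ∃ p ∈ G, p.1 - h • p.2 = f) :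
    ∃ T : ℝ≥0 → X →L[ℝ] X, IsC0Semigroup T ∧ (∀ t u, ‖T t u‖ ≤ ‖u‖) ∧
      generator (fun t u => T t u) = G := by
  -- The shift by 2 keeps h n strictly below δ already at n = 0.
  set h : ℕ → ℝ := fun n => δ / (n + 2) with hh
  have hpos : ∀ n, 0 < h n := fun n => by positivity
  have hlt : ∀ n, h n < δ := fun n => by
    rw [hh, div_lt_iff₀ (by positivity)]
    have : (0 : ℝ) ≤ n := n.cast_nonneg
    nlinarith
  have hlim : Tendsto h atTop (𝓝 0) := by
    have := (tendsto_const_div_atTop_nhds_zero_nat δ).comp (tendsto_add_atTop_nat 2)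
    refine this.congr fun n => ?_
    simp [hh]
  choose J hJc hJG hJ using fun n => hG.exists_resolvent (hpos n) (hR _ (hpos n) (hlt n))
  -- The Yosida approximations: bounded operators with Y n u = J n w for (u, w) in G, hence
  -- converging to w once J n tends strongly to the identity.
  set Y : ℕ → X →L[ℝ] X := fun n => (h n)⁻¹ • (J n - 1) with hY
  have hYJ : ∀ n, ∀ p ∈ G, Y n p.1 = J n p.2 := by
    intro n p hp
    have h1 := hJ n p hp
    rw [map_sub, map_smul, sub_eq_iff_eq_add] at h1
    simp only [hY, smul_apply, sub_apply, one_apply_eq_self]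
    rw [inv_smul_eq_iff₀ (hpos n).ne', h1]
    abel
  have hJid : ∀ u, Tendsto (fun n => J n u) atTop (𝓝 u) := by
    refine tendsto_id_of_contractions hJc hD ?_
    rintro u ⟨w, hw⟩
    rw [tendsto_iff_norm_sub_tendsto_zero]
    refine squeeze_zero (fun _ => norm_nonneg _) (fun n => ?_)
      (show Tendsto (fun n => h n * ‖w‖) atTop (𝓝 0) by simpa using hlim.mul_const ‖w‖)
    have h1 := hJ n _ hw
    rw [map_sub, map_smul, sub_eq_iff_eq_add] at h1
    simp only at h1
    rw [h1, add_sub_cancel_left, norm_smul, Real.norm_of_nonneg (hpos n).le]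
    exact mul_le_mul_of_nonneg_left (hJc n w) (hpos n).le
  have hYlim : ∀ p ∈ G, Tendsto (fun n => Y n p.1) atTop (𝓝 p.2) := fun p hp =>
    (hJid p.2).congr fun n => (hYJ n p hp).symm
  have hcomm : ∀ m n, Commute (Y m) (Y n) := by
    intro m n
    have h1 := resolvent_comm (hpos m) (hpos n) (hJG m) (hJ m) (hJG n) (hJ n)
    exact (((h1.sub_left (Commute.one_left _)).sub_right (Commute.one_right _)).smul_left
      _).smul_right _
  set E : ℕ → ℝ → X →L[ℝ] X := fun n t => NormedSpace.exp (t • Y n) with hE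
  have hEc : ∀ n t, 0 ≤ t → ∀ u, ‖E n t u‖ ≤ ‖u‖ := fun n t ht u =>
    norm_exp_yosida_le (hJc n) (hpos n) ht u
  have hEE : ∀ m n t, 0 ≤ t → ∀ u, ‖E m t u - E n t u‖ ≤ t * ‖Y m u - Y n u‖ :=
    fun m n t ht u => norm_exp_sub_exp_le (hcomm m n) (hEc m) (hEc n) ht u
  have hEid : ∀ n t, 0 ≤ t → ∀ u, ‖E n t u - u‖ ≤ t * ‖Y n u‖ := fun n t ht u => by
    have := norm_exp_sub_exp_le (Commute.zero_right (Y n)) (hEc n) (fun s _ v => by simp) ht u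
    simpa using this
  have hEadd : ∀ n s t, E n (s + t) = E n s * E n t := fun n s t => by
    let _ := NormedAlgebra.restrictScalars ℚ ℝ (X →L[ℝ] X)
    rw [hE]
    simp only
    rw [add_smul, NormedSpace.exp_add_of_commute]
    exact ((Commute.refl (Y n)).smul_left s).smul_right t
  -- On the domain the exponentials are Cauchy by `hEE`; the denominator t + 1 avoids dividing by
  -- zero at t = 0.
  choose T hTc hT using fun t : ℝ≥0 => exists_limit_of_contractions
    (E := fun n => E n t) (fun n => hEc n t t.coe_nonneg) hD (by
      rintro u ⟨w, hw⟩
      rw [Metric.cauchySeq_iff]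
      intro ε hε
      obtain ⟨N, hN⟩ := Metric.cauchySeq_iff.1 (hYlim _ hw).cauchySeq (ε / (t + 1)) (by positivity)
      refine ⟨N, fun m hm n hn => ?_⟩
      have h1 := (hN m hm n hn).le
      rw [dist_eq_norm] at h1 ⊢
      refine (hEE m n t t.coe_nonneg u).trans_lt ?_
      calc (t : ℝ) * ‖Y m u - Y n u‖ ≤ t * (ε / (t + 1)) := by gcongr
        _ < (t + 1) * (ε / (t + 1)) := by gcongr; linarith
        _ = ε := by field_simp)
  have hTE : ∀ p ∈ G, ∀ n (t : ℝ≥0), ‖E n t p.1 - T t p.1‖ ≤ t * ‖Y n p.1 - p.2‖ :=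
    fun p hp n t => le_of_tendsto_of_tendsto'
      (tendsto_const_nhds.sub (hT t p.1)).norm
      ((tendsto_const_nhds.sub (hYlim p hp)).norm.const_mul (t : ℝ))
      fun m => hEE n m t t.coe_nonneg p.1
  have hTid : ∀ p ∈ G, ∀ t : ℝ≥0, ‖T t p.1 - p.1‖ ≤ t * ‖p.2‖ :=
    fun p hp t => le_of_tendsto_of_tendsto' ((hT t p.1).sub_const p.1).norm
      ((hYlim p hp).norm.const_mul (t : ℝ)) fun n => hEid n t t.coe_nonneg p.1
  have hTadd : ∀ s t : ℝ≥0, T (s + t) = (T s).comp (T t) := by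
    intro s t
    ext u
    refine tendsto_nhds_unique (hT (s + t) u) ?_
    have h1 : Tendsto (fun n => E n s (E n t u - T t u)) atTop (𝓝 0) :=
      squeeze_zero_norm (fun n => hEc n s s.coe_nonneg _)
        (tendsto_iff_norm_sub_tendsto_zero.1 (hT t u))
    have h2 := h1.add (hT s (T t u))
    rw [zero_add] at h2
    refine h2.congr fun n => ?_
    rw [NNReal.coe_add, hEadd, map_sub, sub_add_cancel]
    rfl
  have hT0 : T 0 = ContinuousLinearMap.id ℝ X := by
    ext u
    refine tendsto_nhds_unique (hT 0 u) ?_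
    simp [hE]
  have hsub : ∀ u (s t : ℝ≥0), ‖T s u - T t u‖ ≤ ‖T (max s t - min s t) u - u‖ := by
    have key : ∀ u (s t : ℝ≥0), s ≤ t → ‖T t u - T s u‖ ≤ ‖T (t - s) u - u‖ := by
      intro u s t hst
      have h1 : T t u = T s (T (t - s) u) := by
        rw [← ContinuousLinearMap.comp_apply, ← hTadd, add_tsub_cancel_of_le hst]
      rw [h1, ← map_sub]
      exact hTc _ _
    intro u s t
    rcases le_total s t with hst | hst
    · rw [max_eq_right hst, min_eq_left hst, norm_sub_rev]
      exact key u s t hst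
    · rw [max_eq_left hst, min_eq_right hst]
      exact key u t s hst
  have hcont : ∀ u, Continuous fun t : ℝ≥0 => T t u := by
    have hc1 : ∀ p ∈ G, Continuous fun t : ℝ≥0 => T t p.1 := by
      intro p hp
      refine (LipschitzWith.of_dist_le_mul (K := ‖p.2‖₊) fun s t => ?_).continuous
      rw [dist_eq_norm, mul_comm, coe_nnnorm, NNReal.dist_eq]
      refine (hsub p.1 s t).trans ((hTid p hp _).trans_eq ?_)
      rw [NNReal.coe_sub (min_le_max), NNReal.coe_max, NNReal.coe_min, max_sub_min_eq_abs']
    intro u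
    refine continuous_of_uniform_approx_of_continuous fun V hV => ?_
    obtain ⟨ε, hε, hV⟩ := Metric.mem_uniformity_dist.1 hV
    obtain ⟨w, hw, w', hwD⟩ := Metric.dense_iff.1 hD u ε hε
    refine ⟨fun t => T t w, hc1 _ hwD, fun t => hV ?_⟩
    rw [dist_eq_norm, ← map_sub]
    refine (hTc _ _).trans_lt ?_
    rwa [← dist_eq_norm, dist_comm]
  -- After division by t, the error in replacing T by E n is at most ‖Y n u - w‖ uniformly in t. So
  -- n is fixed first, and then t tends to 0.
  have hle : G ≤ generatorSubmodule T := by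
    intro p hp
    rw [mem_generatorSubmodule]
    change Tendsto _ _ _
    rw [Metric.tendsto_nhds]
    intro ε hε
    obtain ⟨n, hn⟩ := ((Metric.tendsto_nhds.1 (hYlim p hp)) (ε / 3) (by positivity)).exists
    have hd : HasDerivAt (fun t => E n t p.1) (Y n p.1) 0 := by
      have := (hasDerivAt_exp_smul_const (𝕂 := ℝ) (Y n) 0).clm_apply (hasDerivAt_const 0 p.1)
      simpa using this
    have h2 := tendsto_slope_nnreal hd
    filter_upwards [Metric.tendsto_nhds.1 h2 (ε / 3) (by positivity), self_mem_nhdsWithin]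
      with t ht ht0
    have ht0' : (0 : ℝ) < t := NNReal.coe_pos.2 ht0
    have e0 : E n 0 p.1 = p.1 := by simp [hE]
    rw [zero_add, e0] at ht
    have h3 : dist ((t : ℝ)⁻¹ • (T t p.1 - p.1)) ((t : ℝ)⁻¹ • (E n t p.1 - p.1)) < ε / 3 := by
      rw [dist_eq_norm, ← smul_sub, sub_sub_sub_cancel_right, norm_smul, norm_inv,
        Real.norm_of_nonneg ht0'.le, inv_mul_lt_iff₀ ht0', norm_sub_rev]
      refine (hTE p hp n t).trans_lt ?_
      rw [← dist_eq_norm]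
      gcongr
    calc _ ≤ dist ((t : ℝ)⁻¹ • (T t p.1 - p.1)) ((t : ℝ)⁻¹ • (E n t p.1 - p.1))
          + dist ((t : ℝ)⁻¹ • (E n t p.1 - p.1)) (Y n p.1) + dist (Y n p.1) p.2 :=
        dist_triangle4 _ _ _ _
      _ < ε / 3 + ε / 3 + ε / 3 := by gcongr
      _ = ε := by ring
  refine ⟨T, ⟨hT0, hTadd, hcont⟩, hTc, ?_⟩
  -- The generator is a dissipative extension of G, so maximality gives equality.
  have := (generator_isDissipative hTc).eq_of_le hle (hpos 0) (hR _ (hpos 0) (hlt 0))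
  rw [← this]
  rfl

lemma generator_exp_smul {T : ℝ≥0 → X →L[ℝ] X} (ω : ℝ) {u w : X}
    (h0 : Tendsto (fun t : ℝ≥0 => T t u) (𝓝[>] 0) (𝓝 u))
    (h : (u, w) ∈ generator fun t u => T t u) :
    (u, w + ω • u) ∈ generator fun t u => (Real.exp (ω * t) • T t) u := by
  have h1 := (tendsto_exp_slope_nnreal ω).smul h0
  refine (Tendsto.add h h1).congr fun t => ?_
  simp only [smul_apply]
  module

/-- Generation theorem for quasi-dissipative operators. -/
theorem exists_semigroup_of_isQuasiDissipative [CompleteSpace X] {G : Submodule ℝ (X × X)} {ω : ℝ}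
    (hG : IsQuasiDissipative ω (G : Set (X × X))) (hD : Dense (domain (G : Set (X × X)))) {l₀ : ℝ}
    (hR : ∀ l, l₀ < l → ∀ f : X, ∃ p ∈ G, l • p.1 - p.2 = f) :
    ∃ T : ℝ≥0 → X →L[ℝ] X, IsC0Semigroup T ∧ generator (fun t u => T t u) = G := by
  set S : X × X →ₗ[ℝ] X × X :=
    (LinearMap.fst ℝ X X).prod (LinearMap.snd ℝ X X + ω • LinearMap.fst ℝ X X)
  have hSa : ∀ p : X × X, S p = (p.1, p.2 + ω • p.1) := fun p => rfl
  -- G' is G - ω, which is dissipative; its semigroup is multiplied by exp(ωt) at the end.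
  set G' : Submodule ℝ (X × X) := G.comap S with hG'
  have hmem : ∀ p : X × X, p ∈ G' ↔ (p.1, p.2 + ω • p.1) ∈ G := fun p => Iff.rfl
  have hmem' : ∀ p : X × X, p ∈ G → (p.1, p.2 - ω • p.1) ∈ G' := fun p hp => by
    rw [hmem]
    simpa using hp
  have hdiss : IsDissipative G' := by
    refine IsQuasiDissipative.isDissipative fun p hp φ hφ hu => ?_
    have := hG _ hp φ hφ hu
    simp only [hSa, map_add, map_smul, smul_eq_mul, hu] at this
    linarith
  have hdense : Dense (domain (G' : Set (X × X))) :=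
    hD.mono <| by
      rintro u ⟨w, hw⟩
      exact ⟨_, hmem' _ hw⟩
  -- For h below this value, l = h⁻¹ + ω exceeds l₀, and h(l - G) = 1 - hG'.
  have hδ : 0 < (|l₀ - ω| + 1)⁻¹ := by positivity
  obtain ⟨T, hT, hTc, hgen⟩ := exists_semigroup_of_isDissipative hdiss hdense hδ (by
    intro h hh hhδ f
    have h1 : |l₀ - ω| + 1 < h⁻¹ := (lt_inv_comm₀ hh (by positivity)).1 hhδ
    have h2 : l₀ < h⁻¹ + ω := by
      have := le_abs_self (l₀ - ω)
      linarith
    obtain ⟨q, hq, hqf⟩ := hR _ h2 (h⁻¹ • f)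
    refine ⟨_, hmem' q hq, ?_⟩
    have h3 : f = h • (h⁻¹ • f) := by rw [smul_inv_smul₀ hh.ne']
    rw [h3, ← hqf]
    match_scalars <;> field_simp <;> ring)
  refine ⟨fun t => Real.exp (ω * t) • T t, ⟨?_, fun s t => ?_, fun u => ?_⟩, ?_⟩
  · simp [hT.zero]
  · ext u
    simp only [smul_apply, hT.add, ContinuousLinearMap.comp_apply, map_smul, smul_smul,
      NNReal.coe_add, mul_add, Real.exp_add, mul_comm (Real.exp (ω * s))]
  · exact (by fun_prop : Continuous fun t : ℝ≥0 => Real.exp (ω * t)).smul (hT.continuous u)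
  · have hcont : Continuous fun t : ℝ≥0 => Real.exp (ω * t) := by fun_prop
    have hnhds : ∀ u, Tendsto (fun t : ℝ≥0 => T t u) (𝓝[>] 0) (𝓝 u) := fun u =>
      ((hT.continuous u).tendsto' 0 u (by simp [hT.zero])).mono_left nhdsWithin_le_nhds
    ext p
    constructor
    · intro hp
      -- The converse inclusion is the same rescaling undone, with -ω in place of ω.
      have h1 := generator_exp_smul (T := fun t : ℝ≥0 => Real.exp (ω * t) • T t) (-ω)
        (u := p.1) (w := p.2) ?_ hp
      · have h2 : (p.1, p.2 + -ω • p.1) ∈ generator fun t u => T t u := by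
          convert! h1 using 4 with t u
          rw [smul_apply, smul_apply, smul_smul, ← Real.exp_add]
          simp
        rw [hgen] at h2
        have h3 := (hmem _).1 h2
        simpa using h3
      · have h2 := (hcont.tendsto' 0 1 (by simp)).mono_left
          (nhdsWithin_le_nhds (s := Set.Ioi 0))
        simpa using h2.smul (hnhds p.1)
    · intro hp
      have h1 : (p.1, p.2 - ω • p.1) ∈ generator fun t u => T t u := by
        rw [hgen]
        exact hmem' p hp
      simpa using generator_exp_smul ω (hnhds p.1) h1

/-- A dissipative evolution starting at `0` vanishes. -/
lemma eq_zero_of_isDissipative {G : Submodule ℝ (X × X)} (hG : IsDissipative G) {V V' : ℝ → X}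
    (hV : ∀ t, HasDerivAt V (V' t) t) (hmem : ∀ t, 0 ≤ t → (V t, V' t) ∈ G) (h0 : V 0 = 0) {t : ℝ}
    (ht : 0 ≤ t) : V t = 0 := by
  have hcont : Continuous V := continuous_iff_continuousAt.2 fun t => (hV t).continuousAt
  -- Dissipativity compares V(r) with the earlier V(r - h): ‖V(r)‖ ≤ ‖V(r) - hV'(r)‖ = ‖V(r - h)‖ +
  -- o(h). Reversing time turns this into a bound on right slopes, and the endpoint s = t reads
  -- ‖V(t)‖ ≤ ‖V(0)‖.
  have key := image_le_of_liminf_slope_right_le_deriv_boundary (f := fun s => -‖V (t - s)‖)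
    (a := 0) (b := t) (B := fun _ => -‖V t‖) (B' := fun _ => 0) (by fun_prop) (by simp)
    continuousOn_const (fun s _ => hasDerivWithinAt_const _ _ _) (by
      intro s hs r hr
      refine Eventually.frequently ?_
      have h1 := hasDerivAt_iff_tendsto_slope_zero.1 (hV (t - s))
      have h2 : Tendsto (fun z : ℝ => s - z) (𝓝[>] s) (𝓝[≠] 0) := by
        refine tendsto_nhdsWithin_iff.2 ⟨?_, ?_⟩
        · exact ((by fun_prop : Continuous fun z : ℝ => s - z).tendsto' s 0 (sub_self s)).mono_left
            nhdsWithin_le_nhds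
        · filter_upwards [self_mem_nhdsWithin] with z hz
          exact (sub_neg.2 hz).ne
      filter_upwards [Metric.tendsto_nhds.1 (h1.comp h2) r hr, self_mem_nhdsWithin] with z hz hsz
      have hsz' : 0 < z - s := sub_pos.2 hsz
      have h3 := hG _ (hmem (t - s) (by linarith [hs.2])) _ hsz'
      have h4 : t - s + (s - z) = t - z := by ring
      rw [Function.comp_apply, h4, dist_eq_norm] at hz
      have h5 : V (t - s) - (z - s) • V' (t - s) - V (t - z)
          = (z - s) • ((s - z)⁻¹ • (V (t - z) - V (t - s)) - V' (t - s)) := by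
        rw [← neg_sub z s, inv_neg, neg_smul, smul_sub, smul_neg, smul_inv_smul₀ hsz'.ne']
        abel
      have h6 : ‖V (t - s) - (z - s) • V' (t - s)‖ - ‖V (t - z)‖ ≤
          (z - s) * ‖(s - z)⁻¹ • (V (t - z) - V (t - s)) - V' (t - s)‖ := by
        refine (norm_sub_norm_le _ _).trans_eq ?_
        rw [h5, norm_smul, Real.norm_of_nonneg hsz'.le]
      rw [slope_def_field, div_lt_iff₀ hsz']
      have h7 := mul_lt_mul_of_pos_left hz hsz'
      simp only at h3
      linarith)
  have h1 := key ⟨ht, le_rfl⟩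
  simp only [sub_self, h0, norm_zero, neg_zero] at h1
  exact norm_le_zero_iff.1 (by linarith)

/-- Mild solutions for a quasi-dissipative operator are unique. -/
theorem IsMildSolution.unique [CompleteSpace X] {G : Submodule ℝ (X × X)} {ω : ℝ}
    (hG : IsQuasiDissipative ω (G : Set (X × X))) {v₀ : X} {v w : ℝ≥0 → X}
    (hv : IsMildSolution (G : Set (X × X)) v₀ v) (hw : IsMildSolution (G : Set (X × X)) v₀ w) :
    v = w := by
  set S : X × X →ₗ[ℝ] X × X :=
    (LinearMap.fst ℝ X X).prod (LinearMap.snd ℝ X X + ω • LinearMap.fst ℝ X X)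
  have hSa : ∀ p : X × X, S p = (p.1, p.2 + ω • p.1) := fun p => rfl
  have hdiss : IsDissipative (G.comap S) := by
    refine IsQuasiDissipative.isDissipative fun p hp φ hφ hu => ?_
    have := hG _ hp φ hφ hu
    simp only [hSa, map_add, map_smul, smul_eq_mul, hu] at this
    linarith
  have hvc : Continuous fun s : ℝ => v s.toNNReal := hv.1.comp continuous_real_toNNReal
  have hwc : Continuous fun s : ℝ => w s.toNNReal := hw.1.comp continuous_real_toNNReal
  set g : ℝ → X := fun s => v s.toNNReal - w s.toNNReal with hg
  have hgc : Continuous g := hvc.sub hwc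
  set W : ℝ → X := fun t => ∫ s in (0 : ℝ)..t, g s with hW
  have hWd : ∀ t, HasDerivAt W (g t) t := fun t => (hgc.integral_hasStrictDerivAt 0 t).hasDerivAt
  have hWG : ∀ t : ℝ≥0, (W t, g t) ∈ G := by
    intro t
    have h1 := G.sub_mem (hv.2 t) (hw.2 t)
    rwa [Prod.mk_sub_mk, sub_sub_sub_cancel_right, ← intervalIntegral.integral_sub
      (hvc.intervalIntegrable _ _) (hwc.intervalIntegrable _ _),
      show v t - w t = g t by simp [hg]] at h1
  have hzero : ∀ t : ℝ, 0 ≤ t → W t = 0 := by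
    intro t ht
    -- The factor exp(-ωt) turns an evolution for G into one for the dissipative relation G - ω.
    have hd : ∀ t : ℝ, HasDerivAt (fun t => Real.exp (-ω * t) • W t)
        (Real.exp (-ω * t) • (g t - ω • W t)) t := by
      intro t
      have h1 : HasDerivAt (fun t : ℝ => Real.exp (-ω * t)) (Real.exp (-ω * t) * (-ω * 1)) t :=
        ((hasDerivAt_id t).const_mul (-ω)).exp
      convert! h1.smul (hWd t) using 1
      module
    have h2 := eq_zero_of_isDissipative hdiss hd (fun t ht => ?_) (by simp [hW]) ht
    · exact (smul_eq_zero_iff_right (Real.exp_pos _).ne').1 h2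
    · rw [← Prod.smul_mk]
      refine Submodule.smul_mem _ _ ?_
      have h3 : (W t, g t) ∈ G := hWG ⟨t, ht⟩
      rw [Submodule.mem_comap, hSa]
      simpa using h3
  ext t
  have h1 : (0, g t) ∈ G := by
    have := hWG t
    rwa [hzero t t.coe_nonneg] at this
  -- W is known to vanish only on [0, ∞), so a one-sided derivative is taken; this covers t = 0.
  have h2 : HasDerivWithinAt W (g t) (Set.Ici (t : ℝ)) t := (hWd t).hasDerivWithinAt
  have h3 : HasDerivWithinAt W 0 (Set.Ici (t : ℝ)) t :=
    (hasDerivWithinAt_const _ _ (0 : X)).congr (fun s hs => hzero s (t.coe_nonneg.trans hs))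
      (hzero t t.coe_nonneg)
  have h4 : g t = 0 := (uniqueDiffOn_Ici (t : ℝ) t Set.self_mem_Ici).eq_deriv _ h2 h3
  simpa [hg, sub_eq_zero] using h4

end HilleYosida

/-! ### Relatively bounded perturbation of a contraction semigroup. -/

section Perturbation

variable {X : Type*} [NormedAddCommGroup X] [NormedSpace ℝ X]

/-- The sum of two linear relations. -/
def opSumSubmodule (A B : Submodule ℝ (X × X)) : Submodule ℝ (X × X) where
  carrier := opSum (A : Set (X × X)) B
  add_mem' := by
    rintro p q ⟨a, b, ha, hb, h⟩ ⟨a', b', ha', hb', h'⟩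
    refine ⟨a + a', b + b', A.add_mem ha ha', B.add_mem hb hb', ?_⟩
    rw [Prod.snd_add, h, h']
    abel
  zero_mem' := ⟨0, 0, A.zero_mem, B.zero_mem, by simp⟩
  smul_mem' := by
    rintro c p ⟨a, b, ha, hb, h⟩
    refine ⟨c • a, c • b, A.smul_mem c ha, B.smul_mem c hb, ?_⟩
    rw [Prod.smul_snd, h, smul_add]

lemma IsQuasiDissipative.opSum {A B : Set (X × X)} {α β : ℝ} (hA : IsQuasiDissipative α A)
    (hB : IsQuasiDissipative β B) : IsQuasiDissipative (α + β) (opSum A B) := by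
  rintro p ⟨a, b, ha, hb, h⟩ φ hφ hu
  have h1 := hA _ ha φ hφ hu
  have h2 := hB _ hb φ hφ hu
  rw [h, map_add]
  simp only at h1 h2
  linarith

/-- Banach's fixed point theorem for f ↦ g + P f, standing for the Neumann series of (1 - P)⁻¹. -/
lemma exists_sub_eq_of_half_contraction {Y : Type*} [NormedAddCommGroup Y] [CompleteSpace Y]
    {P : Y → Y} (hP : ∀ f g, ‖P f - P g‖ ≤ 1 / 2 * ‖f - g‖) (g : Y) : ∃ f, f - P f = g := by
  have hc : ContractingWith (1 / 2 : ℝ≥0) fun f => g + P f := by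
    refine ⟨NNReal.half_lt_self one_ne_zero, LipschitzWith.of_dist_le_mul fun f f' => ?_⟩
    rw [dist_eq_norm, dist_eq_norm, add_sub_add_left_eq_sub]
    simpa using hP f f'
  refine ⟨hc.fixedPoint, ?_⟩
  have := hc.fixedPoint_isFixedPt
  nth_rewrite 1 [← this]
  simp

/-- `(B, P)` is relatively bounded with respect to the resolvent of `A` with bound `1/2`. -/
def IsHalfBounded (TA : ℝ≥0 → X →L[ℝ] X) (B : Set (X × X)) (l : ℝ) (P : X → X) : Prop :=
  ∀ f, (IsC0Semigroup.laplace TA l f, P f) ∈ B ∧ ‖P f‖ ≤ 1 / 2 * ‖f‖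

lemma laplace_sub {T : ℝ≥0 → X →L[ℝ] X} (hT : IsC0Semigroup T)
    (hc : ∀ t u, ‖T t u‖ ≤ ‖u‖) {l : ℝ} (hl : 0 < l) (f g : X) :
    IsC0Semigroup.laplace T l (f - g) = IsC0Semigroup.laplace T l f -
      IsC0Semigroup.laplace T l g := by
  rw [IsC0Semigroup.laplace, IsC0Semigroup.laplace, IsC0Semigroup.laplace,
    ← integral_sub (hT.integrableOn_laplace hc hl f) (hT.integrableOn_laplace hc hl g)]
  simp only [map_sub, smul_sub]

variable [CompleteSpace X]

/-- Both sides solve (l - A)v = lu - a, and dissipativity makes the solution unique. In particular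
every element of D(A) is a Laplace transform. -/
lemma IsC0Semigroup.eq_laplace {T : ℝ≥0 → X →L[ℝ] X} (hT : IsC0Semigroup T)
    (hc : ∀ t u, ‖T t u‖ ≤ ‖u‖) {l : ℝ} (hl : 0 < l) {u a : X}
    (h : (u, a) ∈ generator fun t u => T t u) : u = laplace T l (l • u - a) := by
  have h1 := hT.laplace_mem_generator hc hl (l • u - a)
  have h2 := generator_isDissipative hc _ ((generatorSubmodule T).sub_mem h h1) l⁻¹ (inv_pos.2 hl)
  have h3 : u - laplace T l (l • u - a) -
      l⁻¹ • (a - (l • laplace T l (l • u - a) - (l • u - a))) = 0 := by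
    match_scalars <;> field_simp <;> ring
  simp only [Prod.mk_sub_mk] at h2
  rw [h3, norm_zero, norm_le_zero_iff, sub_eq_zero] at h2
  exact h2

/-- Perturbation of the generator `A` of a contraction semigroup by a quasi-dissipative operator `B`
whose relative bound with respect to the resolvents of `A` is eventually at most `1/2`. -/
theorem exists_semigroup_opSum {TA TB : ℝ≥0 → X →L[ℝ] X} (hTA : IsC0Semigroup TA)
    (hc : ∀ t u, ‖TA t u‖ ≤ ‖u‖) {ω : ℝ}
    (hTB : ∀ (t : ℝ≥0) u, ‖TB t u‖ ≤ Real.exp (ω * t) * ‖u‖) {l₀ : ℝ} {P : ℝ → X → X}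
    (hl₀ : 0 ≤ l₀) (hP : ∀ l, l₀ < l → IsHalfBounded TA (generator fun t u => TB t u) l (P l)) :
    domain (generator fun t u => TA t u) ⊆ domain (generator fun t u => TB t u) ∧
      ∃ T : ℝ≥0 → X →L[ℝ] X, IsC0Semigroup T ∧ generator (fun t u => T t u) =
        opSum (generator fun t u => TA t u) (generator fun t u => TB t u) ∧
      (∀ (v₀ : X) (v : ℝ≥0 → X), IsMildSolution
        (opSum (generator fun t u => TA t u) (generator fun t u => TB t u)) v₀ v ↔
          v = fun t => T t v₀) ∧
      ∀ m : StrongDual ℝ X, (∀ t u, m (TA t u) = m u) → (∀ l, l₀ < l → ∀ f, m (P l f) = 0) →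
        ∀ t u, m (T t u) = m u := by
  have hdom : ∀ l, l₀ < l → ∀ u a, (u, a) ∈ (generator fun t u => TA t u) →
      (u, P l (l • u - a)) ∈ generator fun t u => TB t u := by
    intro l hl u a h
    have h1 := (hP l hl (l • u - a)).1
    rwa [← hTA.eq_laplace hc (hl₀.trans_lt hl) h] at h1
  have hl₁ : l₀ < l₀ + 1 := by linarith
  have hsub : domain (generator fun t u => TA t u) ⊆ domain (generator fun t u => TB t u) := by
    rintro u ⟨a, ha⟩
    exact ⟨_, hdom _ hl₁ u a ha⟩
  refine ⟨hsub, ?_⟩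
  set G := opSumSubmodule (generatorSubmodule TA) (generatorSubmodule TB)
  have hA : IsQuasiDissipative 0 (generator fun t u => TA t u) := fun p hp φ hφ hu =>
    generator_apply_le (fun t => by simpa using hc t _) hp hφ hu
  have hB : IsQuasiDissipative ω (generator fun t u => TB t u) := fun p hp φ hφ hu =>
    generator_apply_le (fun t => hTB t _) hp hφ hu
  have hGq : IsQuasiDissipative (0 + ω) (G : Set (X × X)) := hA.opSum hB
  have hdense : Dense (domain (G : Set (X × X))) := by
    refine hTA.dense_domain_generator.mono ?_
    rintro u ⟨a, ha⟩
    exact ⟨_, a, _, ha, hdom _ hl₁ u a ha, rfl⟩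
  have hrange : ∀ l, l₀ < l → ∀ g : X, ∃ p ∈ G, l • p.1 - p.2 = g := by
    intro l hl g
    have hl' := hl₀.trans_lt hl
    -- P l is given only as a function; its compatibility with differences comes from the generator
    -- of TB being single-valued.
    have hsubP : ∀ f f', P l f - P l f' = P l (f - f') := by
      intro f f'
      have h1 := (generatorSubmodule TB).sub_mem (hP l hl f).1 (hP l hl f').1
      rw [Prod.mk_sub_mk, ← laplace_sub hTA hc hl'] at h1
      exact generator_unique h1 (hP l hl (f - f')).1
    -- Factor l - A - B = (1 - P)(l - A): solve f - P f = g, then apply the resolvent of A to f.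
    obtain ⟨f, hf⟩ := exists_sub_eq_of_half_contraction (P := P l)
      (fun f f' => by rw [hsubP]; exact (hP l hl _).2) g
    refine ⟨(IsC0Semigroup.laplace TA l f, l • IsC0Semigroup.laplace TA l f - f + P l f),
      ⟨_, _, hTA.laplace_mem_generator hc hl' f, (hP l hl f).1, rfl⟩, ?_⟩
    rw [← hf]
    simp only
    abel
  obtain ⟨T, hT, hgen⟩ := exists_semigroup_of_isQuasiDissipative hGq hdense hrange
  have hmild : ∀ v₀, IsMildSolution (G : Set (X × X)) v₀ fun t => T t v₀ := fun v₀ => by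
    rw [← hgen]
    exact hT.isMildSolution v₀
  refine ⟨T, hT, hgen, fun v₀ v => ⟨fun hv => ?_, fun hv => ?_⟩, fun m hmA hmB t u => ?_⟩
  · exact IsMildSolution.unique hGq hv (hmild v₀)
  · rw [hv]
    exact hmild v₀
  · obtain ⟨a, b, ha, hb, h⟩ := (hmild u).2 t
    have h1 : m a = 0 := generator_apply_eq_zero m (fun t => hmA t _) ha
    have h2 : m b = 0 := by
      -- On D(A) the value of B is P l (lu - a), so its m-value is zero by `hmB`.
      rw [generator_unique hb (hdom _ hl₁ _ _ ha)]
      exact hmB _ hl₁ _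
    have h3 : m (T t u - u) = 0 := by
      simp only at h
      rw [h, map_add, h1, h2, add_zero]
    rwa [map_sub, sub_eq_zero] at h3

end Perturbation

/-! ### L¹ of the plane: mass, vector-valued integrals, translations. -/

section Lebesgue

/-- The integral over a set, as a functional on `L¹`. -/
def massOn (s : Set Plane) : StrongDual ℝ L1 :=
  (L1.integralCLM (μ := (volume : Measure Plane).restrict s)).comp
    (LpToLpRestrictCLM Plane ℝ ℝ volume 1 s)

lemma massOn_apply (s : Set Plane) (u : L1) : massOn s u = ∫ x in s, u x := by
  rw [← integral_congr_ae (LpToLpRestrictCLM_coeFn ℝ s u), ← L1.integral_eq_integral,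
    L1.integral_eq]
  rfl

/-- The total mass, as a functional on `L¹`. -/
def mass : StrongDual ℝ L1 := massOn Set.univ

lemma mass_apply (u : L1) : mass u = ∫ x, u x := by
  rw [mass, massOn_apply, setIntegral_univ]

lemma toL1_of_integrable {f : Plane → ℝ} (hf : Integrable f) : toL1 f = hf.toL1 f := by
  rw [toL1, dif_pos hf]

lemma coeFn_toL1 {f : Plane → ℝ} (hf : Integrable f) : toL1 f =ᵐ[volume] f := by
  rw [toL1_of_integrable hf]
  exact hf.coeFn_toL1

lemma toL1_congr {f g : Plane → ℝ} (h : f =ᵐ[volume] g) : toL1 f = toL1 g := by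
  by_cases hf : Integrable f
  · rw [toL1_of_integrable hf, toL1_of_integrable (hf.congr h)]
    exact (Integrable.toL1_eq_toL1_iff _ _ _ _).2 h
  · rw [toL1, toL1, dif_neg hf, dif_neg fun hg => hf (hg.congr h.symm)]

lemma toL1_coeFn (u : L1) : toL1 u = u := by
  rw [toL1_of_integrable (L1.integrable_coeFn u), Integrable.toL1_coeFn]

lemma eq_toL1_of_ae {u : L1} {f : Plane → ℝ} (h : u =ᵐ[volume] f) : u = toL1 f := by
  rw [← toL1_congr h, toL1_coeFn]

lemma norm_toL1 {f : Plane → ℝ} (hf : Integrable f) : ‖toL1 f‖ = ∫ x, ‖f x‖ := by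
  rw [toL1_of_integrable hf, L1.norm_of_fun_eq_integral_norm]

lemma mass_toL1 {f : Plane → ℝ} (hf : Integrable f) : mass (toL1 f) = ∫ x, f x := by
  rw [mass_apply, integral_congr_ae (coeFn_toL1 hf)]

/-- Bochner integrals in `L¹` can be evaluated almost everywhere. -/
lemma integral_eq_toL1 {Φ : Plane → L1} (hΦ : Integrable Φ) {F : Plane → Plane → ℝ}
    (hF : Integrable (Function.uncurry F) (volume.prod volume))
    (h : ∀ᵐ z, Φ z =ᵐ[volume] F z) : ∫ z, Φ z = toL1 fun x => ∫ z, F z x := by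
  have hint : Integrable fun x => ∫ z, F z x := hF.integral_prod_right
  -- Two integrable functions agree almost everywhere if their integrals over all measurable sets of
  -- finite measure agree. Each such integral is a continuous functional, so it passes inside the
  -- Bochner integral, and Fubini concludes.
  refine eq_toL1_of_ae (Integrable.ae_eq_of_forall_setIntegral_eq _ _ (L1.integrable_coeFn _) hint
    fun s hs _ => ?_)
  have hFs : Integrable (Function.uncurry fun x z => F z x) ((volume.restrict s).prod volume) := by
    have h1 := hF.swap
    have h2 : Integrable (Function.uncurry fun x z => F z x)
        (((volume : Measure Plane).prod (volume : Measure Plane)).restrict (s ×ˢ Set.univ)) :=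
      h1.integrableOn
    rwa [← Measure.prod_restrict, Measure.restrict_univ] at h2
  rw [← massOn_apply, ← ContinuousLinearMap.integral_comp_comm _ hΦ, integral_integral_swap hFs]
  refine integral_congr_ae ?_
  filter_upwards [h] with z hz
  rw [massOn_apply]
  exact integral_congr_ae (ae_restrict_of_ae hz)

/-- Translations on `L¹`: `(translate y u)(x) = u(y + x)`. -/
def translate (y : Plane) : L1 →L[ℝ] L1 :=
  (Lp.compMeasurePreservingₗᵢ ℝ (fun x => y + x)
    (measurePreserving_add_left volume y)).toContinuousLinearMap

lemma coeFn_translate (y : Plane) (u : L1) : translate y u =ᵐ[volume] fun x => u (y + x) :=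
  Lp.coeFn_compMeasurePreserving u (measurePreserving_add_left volume y)

lemma norm_translate (y : Plane) (u : L1) : ‖translate y u‖ = ‖u‖ :=
  Lp.norm_compMeasurePreserving u (measurePreserving_add_left volume y)

lemma continuous_translate (u : L1) : Continuous fun y => translate y u := by
  let g : C(Plane, C(Plane, Plane)) :=
    ContinuousMap.curry ⟨fun p : Plane × Plane => p.1 + p.2, continuous_add⟩
  exact Continuous.compMeasurePreservingLp (f := fun _ : Plane => u) (g := g) continuous_const
    g.continuous (fun y => measurePreserving_add_left volume y) ENNReal.one_ne_top

lemma translate_translate (y z : Plane) (u : L1) :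
    translate y (translate z u) = translate (y + z) u := by
  refine Lp.ext ?_
  have h1 := (measurePreserving_add_left volume y).quasiMeasurePreserving.ae (coeFn_translate z u)
  filter_upwards [coeFn_translate y (translate z u), coeFn_translate (y + z) u, h1] with x h2 h3 h4
  rw [h2, h3, h4]
  congr 1
  abel

lemma translate_zero (u : L1) : translate 0 u = u := by
  refine Lp.ext ?_
  filter_upwards [coeFn_translate 0 u] with x h
  rw [h, zero_add]

lemma mass_translate (y : Plane) (u : L1) : mass (translate y u) = mass u := by
  rw [mass_apply, mass_apply, integral_congr_ae (coeFn_translate y u)]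
  exact integral_add_left_eq_self (fun x => u x) y

end Lebesgue

/-! ### Gaussian identities for the heat kernel. -/

section Kernel

variable {ε t : ℝ}

lemma heatKernel_pos (hε : 0 < ε) (ht : 0 < t) (x : Plane) : 0 < heatKernel ε t x := by
  unfold heatKernel
  positivity

lemma continuous_heatKernel (ε t : ℝ) : Continuous (heatKernel ε t) := by
  unfold heatKernel
  fun_prop

lemma heatKernel_neg (ε t : ℝ) (x : Plane) : heatKernel ε t (-x) = heatKernel ε t x := by
  simp [heatKernel]

lemma integral_exp_neg_mul_sq {b : ℝ} (hb : 0 < b) (p : Plane) :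
    ∫ x : Plane, Real.exp (-b * ‖x - p‖ ^ 2) = Real.pi / b := by
  rw [integral_sub_right_eq_self (fun x : Plane => Real.exp (-b * ‖x‖ ^ 2)) p,
    GaussianFourier.integral_rexp_neg_mul_sq_norm hb]
  simp

lemma integral_heatKernel (hε : 0 < ε) (ht : 0 < t) : ∫ x, heatKernel ε t x = 1 := by
  have h := integral_exp_neg_mul_sq (b := 1 / (4 * ε ^ 2 * t)) (by positivity) 0
  have h2 : ∀ x : Plane, heatKernel ε t x = 1 / (4 * Real.pi * ε ^ 2 * t) *
      Real.exp (-(1 / (4 * ε ^ 2 * t)) * ‖x - 0‖ ^ 2) := fun x => by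
    rw [heatKernel, sub_zero]
    congr 2
    ring
  simp_rw [h2]
  rw [integral_const_mul, h]
  have := Real.pi_pos
  field_simp

lemma integrable_heatKernel (hε : 0 < ε) (ht : 0 < t) : Integrable (heatKernel ε t) :=
  -- Non-integrable functions have integral 0 by convention, so a non-zero integral proves
  -- integrability.
  .of_integral_ne_zero (by rw [integral_heatKernel hε ht]; exact one_ne_zero)

lemma heatKernel_convolution (hε : 0 < ε) {s : ℝ} (hs : 0 < s) (ht : 0 < t) (x : Plane) :
    ∫ y, heatKernel ε s y * heatKernel ε t (x - y) = heatKernel ε (s + t) x := by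
  -- Completing the square in y: the sum of the two exponents is a Gaussian exponent of rate b
  -- centred at (s/(s + t))x plus the exponent of time s + t at x.
  set b := (s + t) / (4 * ε ^ 2 * s * t) with hb
  have hbpos : 0 < b := by positivity
  have h1 : ∀ y, heatKernel ε s y * heatKernel ε t (x - y) =
      (1 / (4 * Real.pi * ε ^ 2 * s) * (1 / (4 * Real.pi * ε ^ 2 * t)) *
        Real.exp (-‖x‖ ^ 2 / (4 * ε ^ 2 * (s + t)))) *
        Real.exp (-b * ‖y - (s / (s + t)) • x‖ ^ 2) := by
    intro y
    rw [heatKernel, heatKernel, mul_mul_mul_comm, ← Real.exp_add,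
      mul_assoc (1 / (4 * Real.pi * ε ^ 2 * s) * (1 / (4 * Real.pi * ε ^ 2 * t))),
      ← Real.exp_add]
    congr 2
    rw [norm_sub_sq_real, norm_sub_sq_real, inner_smul_right, norm_smul, Real.norm_eq_abs, mul_pow,
      sq_abs, real_inner_comm, hb]
    field_simp
    ring
  simp_rw [h1]
  rw [integral_const_mul, integral_exp_neg_mul_sq hbpos, heatKernel, hb]
  have := Real.pi_pos
  field_simp

/-- Parabolic scaling; the factor t = (√t)² is the Jacobian of the dilation by √t in dimension two.
-/
lemma heatKernel_one_eq (ε : ℝ) (ht : 0 < t) (w : Plane) :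
    heatKernel ε 1 w = t * heatKernel ε t (√t • w) := by
  rw [heatKernel, heatKernel, norm_smul, Real.norm_of_nonneg (Real.sqrt_nonneg t), mul_pow,
    Real.sq_sqrt ht.le]
  rcases eq_or_ne ε 0 with rfl | hε
  · simp
  · have := Real.pi_pos
    have h1 : -(t * ‖w‖ ^ 2) / (4 * ε ^ 2 * t) = -‖w‖ ^ 2 / (4 * ε ^ 2 * 1) := by field_simp
    rw [h1]
    field_simp

end Kernel

/-! ### The heat semigroup on L¹. -/

section Heat

variable {ε : ℝ}

lemma integrable_heatKernel_smul_translate (hε : 0 < ε) {t : ℝ} (ht : 0 < t) (c : ℝ) (u : L1) :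
    Integrable fun w => heatKernel ε t w • translate (c • w) u := by
  refine ((integrable_heatKernel hε ht).mul_const ‖u‖).mono' ?_ (Eventually.of_forall fun w => ?_)
  · exact ((continuous_heatKernel ε t).smul
      ((continuous_translate u).comp (continuous_const_smul c))).aestronglyMeasurable
  · rw [norm_smul, norm_translate, Real.norm_of_nonneg (heatKernel_pos hε ht w).le]

/-- The heat semigroup as an average of translations. -/
def heatCLM (hε : 0 < ε) (t : ℝ≥0) : L1 →L[ℝ] L1 :=
  LinearMap.mkContinuous
    -- Fixing the kernel at time 1 and scaling the translations covers t = 0 by the same formula and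
    -- makes strong continuity a dominated convergence.
    { toFun := fun u => ∫ w, heatKernel ε 1 w • translate (√(t : ℝ) • w) u
      map_add' := fun u v => by
        rw [← integral_add (integrable_heatKernel_smul_translate hε one_pos _ u)
          (integrable_heatKernel_smul_translate hε one_pos _ v)]
        simp only [map_add, smul_add]
      map_smul' := fun c u => by
        rw [RingHom.id_apply, ← integral_smul]
        simp only [map_smul, smul_comm c] } 1 fun u => by
    refine (norm_integral_le_integral_norm _).trans_eq ?_
    simp_rw [norm_smul, norm_translate, Real.norm_of_nonneg (heatKernel_pos hε one_pos _).le]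
    rw [integral_mul_const, integral_heatKernel hε one_pos]

lemma heatCLM_apply (hε : 0 < ε) (t : ℝ≥0) (u : L1) :
    heatCLM hε t u = ∫ w, heatKernel ε 1 w • translate (√(t : ℝ) • w) u := rfl

lemma norm_heatCLM_le (hε : 0 < ε) (t : ℝ≥0) (u : L1) : ‖heatCLM hε t u‖ ≤ ‖u‖ :=
  (ContinuousLinearMap.le_of_opNorm_le _ (LinearMap.mkContinuous_norm_le _ zero_le_one _)
    u).trans_eq (one_mul _)

lemma mass_heatCLM (hε : 0 < ε) (t : ℝ≥0) (u : L1) : mass (heatCLM hε t u) = mass u := by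
  rw [heatCLM_apply, ← ContinuousLinearMap.integral_comp_comm _
    (integrable_heatKernel_smul_translate hε one_pos _ u)]
  simp only [map_smul, mass_translate, smul_eq_mul]
  rw [integral_mul_const, integral_heatKernel hε one_pos, one_mul]

lemma heatCLM_zero (hε : 0 < ε) : heatCLM hε 0 = ContinuousLinearMap.id ℝ L1 := by
  ext1 u
  simp only [heatCLM_apply, NNReal.coe_zero, Real.sqrt_zero, zero_smul, translate_zero]
  rw [integral_smul_const, integral_heatKernel hε one_pos, one_smul]
  rfl

lemma heatCLM_apply_of_pos (hε : 0 < ε) {t : ℝ≥0} (ht : 0 < t) (u : L1) :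
    heatCLM hε t u = ∫ y, heatKernel ε t y • translate y u := by
  have ht' : (0 : ℝ) < t := ht
  rw [heatCLM_apply]
  simp_rw [heatKernel_one_eq ε ht']
  rw [Measure.integral_comp_smul volume
    (fun y => ((t : ℝ) * heatKernel ε t y) • translate y u) (√(t : ℝ))]
  simp_rw [mul_smul]
  rw [integral_smul, smul_smul, finrank_euclideanSpace, Fintype.card_fin, Real.sq_sqrt ht'.le,
    abs_of_pos (inv_pos.2 ht'), inv_mul_cancel₀ ht'.ne', one_smul]

lemma continuous_heatCLM (hε : 0 < ε) (u : L1) : Continuous fun t => heatCLM hε t u := by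
  simp_rw [heatCLM_apply]
  refine continuous_of_dominated (bound := fun w => heatKernel ε 1 w * ‖u‖)
    (fun t => (integrable_heatKernel_smul_translate hε one_pos _ u).aestronglyMeasurable)
    (fun t => Eventually.of_forall fun w => ?_) ((integrable_heatKernel hε one_pos).mul_const _)
    (Eventually.of_forall fun w => ?_)
  · rw [norm_smul, norm_translate, Real.norm_of_nonneg (heatKernel_pos hε one_pos w).le]
  · have h1 : Continuous fun t : ℝ≥0 => √(t : ℝ) • w := by fun_prop
    exact ((continuous_translate u).comp h1).const_smul (heatKernel ε 1 w)

lemma integrable_uncurry_mul_sub {f g : Plane → ℝ} (hf : Integrable f) (hg : Integrable g) :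
    Integrable (Function.uncurry fun z x => f z * g (x - z)) (volume.prod volume) :=
  (hf.convolution_integrand (ContinuousLinearMap.mul ℝ ℝ) hg).swap

/-- Translations compose additively, so by Fubini the composite averages translations against the
convolution of the two kernels. -/
lemma heatCLM_add (hε : 0 < ε) (s t : ℝ≥0) :
    heatCLM hε (s + t) = (heatCLM hε s).comp (heatCLM hε t) := by
  ext1 u
  rcases eq_or_ne s 0 with rfl | hs
  · simp [heatCLM_zero]
  rcases eq_or_ne t 0 with rfl | ht
  · simp [heatCLM_zero]
  have hs := pos_iff_ne_zero.2 hs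
  have ht := pos_iff_ne_zero.2 ht
  have hs' : (0 : ℝ) < s := hs
  have ht' : (0 : ℝ) < t := ht
  have hi : Integrable fun y => heatKernel ε t y • translate y u := by
    simpa using integrable_heatKernel_smul_translate hε ht' 1 u
  have h1 : ∀ y, translate y (heatCLM hε t u) = ∫ w, heatKernel ε t (w - y) • translate w u := by
    intro y
    rw [heatCLM_apply_of_pos hε ht, ← ContinuousLinearMap.integral_comp_comm _ hi]
    simp only [map_smul, translate_translate]
    rw [← integral_sub_right_eq_self _ y]
    simp only [add_sub_cancel]
  have hprod : Integrable (Function.uncurry fun y w =>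
      heatKernel ε s y • heatKernel ε t (w - y) • translate w u) (volume.prod volume) := by
    refine ((integrable_uncurry_mul_sub (integrable_heatKernel hε hs')
      (integrable_heatKernel hε ht')).mul_const ‖u‖).mono' ?_ (Eventually.of_forall fun p => ?_)
    · have c1 := continuous_heatKernel ε s
      have c2 := continuous_heatKernel ε t
      have c3 := continuous_translate u
      refine Continuous.aestronglyMeasurable ?_
      exact (c1.comp continuous_fst).smul
        ((c2.comp (continuous_snd.sub continuous_fst)).smul (c3.comp continuous_snd))
    · simp only [Function.uncurry]
      rw [norm_smul, norm_smul, norm_translate, Real.norm_of_nonneg (heatKernel_pos hε hs' _).le,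
        Real.norm_of_nonneg (heatKernel_pos hε ht' _).le, mul_assoc]
  rw [ContinuousLinearMap.comp_apply, heatCLM_apply_of_pos hε hs (heatCLM hε t u),
    heatCLM_apply_of_pos hε (add_pos hs ht)]
  simp_rw [h1, ← integral_smul]
  rw [integral_integral_swap hprod]
  refine integral_congr_ae (Eventually.of_forall fun w => ?_)
  simp only [smul_smul]
  rw [integral_smul_const, heatKernel_convolution hε hs' ht', NNReal.coe_add]

lemma isC0Semigroup_heatCLM (hε : 0 < ε) : IsC0Semigroup (heatCLM hε) :=
  ⟨heatCLM_zero hε, heatCLM_add hε, continuous_heatCLM hε⟩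

lemma heatSemigroup_eq (hε : 0 < ε) (t : ℝ≥0) (u : L1) :
    heatSemigroup ε t u = heatCLM hε t u := by
  rcases eq_or_ne t 0 with rfl | ht
  · simp [heatSemigroup, heatCLM_zero]
  have ht' : (0 : ℝ) < t := NNReal.coe_pos.2 (pos_iff_ne_zero.2 ht)
  rw [heatSemigroup, if_neg ht, heatCLM_apply_of_pos hε (pos_iff_ne_zero.2 ht)]
  have hu := L1.integrable_coeFn u
  have hF : Integrable (Function.uncurry fun y x => heatKernel ε t y * u (y + x))
      (volume.prod volume) := by
    -- The reflection y ↦ -y turns x - y into y + x and leaves the even kernel unchanged.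
    have h1 := integrable_uncurry_mul_sub (integrable_heatKernel hε ht') hu
    have h2 := (Measure.measurePreserving_neg (volume : Measure Plane)).prod
      (MeasurePreserving.id (volume : Measure Plane))
    have h3 := h2.integrable_comp_of_integrable h1
    refine h3.congr (Eventually.of_forall fun p => ?_)
    simp [Function.uncurry, heatKernel_neg, add_comm]
  have hΦ : Integrable fun y => heatKernel ε t y • translate y u := by
    simpa using integrable_heatKernel_smul_translate hε ht' 1 u
  rw [integral_eq_toL1 hΦ hF]
  · refine toL1_congr (Eventually.of_forall fun x => ?_)
    simp only
    rw [← integral_add_right_eq_self _ x]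
    refine integral_congr_ae (Eventually.of_forall fun z => ?_)
    simp only [sub_add_cancel_right, heatKernel_neg]
  · refine Eventually.of_forall fun y => ?_
    filter_upwards [Lp.coeFn_smul (heatKernel ε t y) (translate y u), coeFn_translate y u]
      with x h1 h2
    rw [h1, Pi.smul_apply, h2, smul_eq_mul]

lemma diffusionOp_eq (hε : 0 < ε) : diffusionOp ε = generator fun t u => heatCLM hε t u := by
  rw [diffusionOp]
  congr 1
  ext1 t
  ext1 u
  exact heatSemigroup_eq hε t u

/-- The heat kernel centred at `z`, as an element of `L¹`. -/
def heatKernelAt (ε t : ℝ) (z : Plane) : L1 := toL1 fun x => heatKernel ε t (x - z)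

lemma coeFn_heatKernelAt (hε : 0 < ε) {t : ℝ} (ht : 0 < t) (z : Plane) :
    heatKernelAt ε t z =ᵐ[volume] fun x => heatKernel ε t (x - z) :=
  coeFn_toL1 ((integrable_heatKernel hε ht).comp_sub_right z)

lemma norm_heatKernelAt (hε : 0 < ε) {t : ℝ} (ht : 0 < t) (z : Plane) :
    ‖heatKernelAt ε t z‖ = 1 := by
  rw [heatKernelAt, norm_toL1 ((integrable_heatKernel hε ht).comp_sub_right z),
    integral_sub_right_eq_self (fun x => ‖heatKernel ε t x‖) z]
  simp_rw [Real.norm_of_nonneg (heatKernel_pos hε ht _).le]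
  exact integral_heatKernel hε ht

lemma continuous_heatKernelAt (hε : 0 < ε) {t : ℝ} (ht : 0 < t) :
    Continuous (heatKernelAt ε t) := by
  have h1 : heatKernelAt ε t = fun z => translate (-z) (heatKernelAt ε t 0) := by
    ext1 z
    refine (eq_toL1_of_ae ?_).symm
    have h2 := (measurePreserving_add_left volume (-z)).quasiMeasurePreserving.ae
      (coeFn_heatKernelAt hε ht 0)
    filter_upwards [coeFn_translate (-z) (heatKernelAt ε t 0), h2] with x h3 h4
    rw [h3, h4]
    congr 1
    abel
  rw [h1]
  exact (continuous_translate _).comp continuous_neg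

lemma integrable_smul_heatKernelAt (hε : 0 < ε) {t : ℝ} (ht : 0 < t) (u : L1) :
    Integrable fun z => u z • heatKernelAt ε t z := by
  refine (L1.integrable_coeFn u).norm.mono' ?_ (Eventually.of_forall fun z => ?_)
  · exact (L1.integrable_coeFn u).aestronglyMeasurable.smul
      (continuous_heatKernelAt hε ht).aestronglyMeasurable
  · rw [norm_smul, norm_heatKernelAt hε ht, mul_one]

/-- Representing T_A(t)u as a superposition of kernels with weights u(z) reduces every estimate of B
T_A(t) to one on a single kernel, uniform in its centre. -/
lemma heatCLM_eq_integral_heatKernelAt (hε : 0 < ε) {t : ℝ≥0} (ht : 0 < t) (u : L1) :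
    heatCLM hε t u = ∫ z, u z • heatKernelAt ε t z := by
  have ht' : (0 : ℝ) < t := ht
  rw [← heatSemigroup_eq, heatSemigroup, if_neg ht.ne']
  rw [integral_eq_toL1 (integrable_smul_heatKernelAt hε ht' u)
    (integrable_uncurry_mul_sub (L1.integrable_coeFn u) (integrable_heatKernel hε ht'))]
  · refine toL1_congr (Eventually.of_forall fun x => ?_)
    simp only [mul_comm]
  · refine Eventually.of_forall fun z => ?_
    filter_upwards [Lp.coeFn_smul (u z) (heatKernelAt ε t z), coeFn_heatKernelAt hε ht' z]
      with x h1 h2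
    rw [h1, Pi.smul_apply, h2, smul_eq_mul]

end Heat

/-! ### The flow of a bounded Lipschitz field. -/

section Flow

variable {C : Plane → Plane} {K : ℝ≥0} {M : ℝ}

lemma exists_local_trajectory (hK : LipschitzWith K C) (hM : ∀ x, ‖C x‖ ≤ M) (z : Plane) {R : ℝ}
    (hR : 0 < R) :
    ∃ γ : ℝ → Plane, γ 0 = z ∧ ∀ t ∈ Set.Ioo (-R) R, HasDerivAt γ (C (γ t)) t := by
  have hM0 : 0 ≤ M := (norm_nonneg _).trans (hM z)
  have h0 : (0 : ℝ) ∈ Set.Icc (-R) R := ⟨by linarith, hR.le⟩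
  -- A solution cannot leave the ball of radius M R before time R, so Picard–Lindelöf applies on an
  -- interval of any length.
  have hpl : IsPicardLindelof (fun _ : ℝ => C) (⟨0, h0⟩ : Set.Icc (-R) R) z
      (⟨M, hM0⟩ * ⟨R, hR.le⟩) 0 ⟨M, hM0⟩ K :=
    { lipschitzOnWith := fun _ _ => hK.lipschitzOnWith
      continuousOn := fun _ _ => continuousOn_const
      norm_le := fun _ _ x _ => hM x
      mul_max_le := by
        simp only [sub_zero, zero_sub, neg_neg, max_self, NNReal.coe_zero]
        exact le_rfl }
  obtain ⟨γ, hγ0, hγ⟩ := hpl.exists_eq_forall_mem_Icc_hasDerivWithinAt₀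
  exact ⟨γ, hγ0, fun t ht => (hγ t (Set.Ioo_subset_Icc_self ht)).hasDerivAt
    (Icc_mem_nhds ht.1 ht.2)⟩

lemma exists_trajectory (hK : LipschitzWith K C) (hM : ∀ x, ‖C x‖ ≤ M) (z : Plane) :
    ∃ γ : ℝ → Plane, IsTrajectory C z γ := by
  choose γ hγ0 hγ using fun n : ℕ => exists_local_trajectory hK hM z (R := n + 1) (by positivity)
  have heq : ∀ m n : ℕ, m ≤ n → ∀ t ∈ Set.Ioo (-(m + 1 : ℝ)) (m + 1), γ m t = γ n t := by
    intro m n hmn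
    have hmn' : (m : ℝ) ≤ n := by exact_mod_cast hmn
    have h0 : (0 : ℝ) ∈ Set.Ioo (-(m + 1 : ℝ)) (m + 1) := by
      constructor <;> linarith [(m.cast_nonneg : (0 : ℝ) ≤ m)]
    refine ODE_solution_unique_of_mem_Ioo (v := fun _ => C) (s := fun _ => Set.univ)
      (fun _ _ => hK.lipschitzOnWith) h0 (fun t ht => ⟨hγ m t ht, trivial⟩)
      (fun t ht => ⟨hγ n t ⟨?_, ?_⟩, trivial⟩) ((hγ0 m).trans (hγ0 n).symm)
    · linarith [ht.1]
    · linarith [ht.2]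
  have hmem : ∀ t : ℝ, ∀ n : ℕ, |t| ≤ n → t ∈ Set.Ioo (-(n + 1 : ℝ)) (n + 1) := fun t n h => by
    have := abs_le.1 h
    constructor <;> linarith
  refine ⟨fun t => γ ⌈|t|⌉₊ t, by simpa using hγ0 0, fun t => ?_⟩
  -- The glued curve changes index with time; one extra unit gives a single local solution valid on
  -- a neighbourhood of t.
  set N := ⌈|t|⌉₊ + 1 with hN
  have htN : t ∈ Set.Ioo (-(N + 1 : ℝ)) (N + 1) := hmem t N (by
    rw [hN]; push_cast; linarith [Nat.le_ceil |t|])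
  have hev : (fun t => γ ⌈|t|⌉₊ t) =ᶠ[𝓝 t] γ N := by
    have h1 : ∀ᶠ s : ℝ in 𝓝 t, |s| < (N : ℝ) := by
      refine (continuous_abs.tendsto t).eventually_lt_const ?_
      rw [hN]; push_cast; linarith [Nat.le_ceil |t|]
    filter_upwards [h1] with s hs
    exact heq _ _ (Nat.ceil_le.2 hs.le) s (hmem s _ (Nat.le_ceil _))
  have h2 := (hγ N t htN).congr_of_eventuallyEq hev
  rwa [← hev.eq_of_nhds] at h2

lemma isTrajectory_flow (hK : LipschitzWith K C) (hM : ∀ x, ‖C x‖ ≤ M) (z : Plane) :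
    IsTrajectory C z fun t => flow C t z := by
  have h := exists_trajectory hK hM z
  have h1 : (fun t => flow C t z) = h.choose := by
    ext1 t
    rw [flow, dif_pos h]
  rw [h1]
  exact h.choose_spec

lemma IsTrajectory.unique (hK : LipschitzWith K C) {z : Plane} {γ γ' : ℝ → Plane}
    (h : IsTrajectory C z γ) (h' : IsTrajectory C z γ') : γ = γ' :=
  ODE_solution_unique_univ (v := fun _ => C) (s := fun _ => Set.univ) (t₀ := 0)
    (fun _ => hK.lipschitzOnWith) (fun t => ⟨h.2 t, trivial⟩) (fun t => ⟨h'.2 t, trivial⟩)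
    (h.1.trans h'.1.symm)

lemma flow_flow (hK : LipschitzWith K C) (hM : ∀ x, ‖C x‖ ≤ M) (s t : ℝ) (z : Plane) :
    flow C s (flow C t z) = flow C (s + t) z := by
  have h1 : IsTrajectory C (flow C t z) fun s => flow C (s + t) z :=
    ⟨by simp only [zero_add], fun s => ((isTrajectory_flow hK hM z).2 (s + t)).comp_add_const s t⟩
  exact congrFun ((isTrajectory_flow hK hM _).unique hK h1) s

lemma flow_zero (hK : LipschitzWith K C) (hM : ∀ x, ‖C x‖ ≤ M) (z : Plane) : flow C 0 z = z :=
  (isTrajectory_flow hK hM z).1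

lemma flow_neg_flow (hK : LipschitzWith K C) (hM : ∀ x, ‖C x‖ ≤ M) (t : ℝ) (z : Plane) :
    flow C (-t) (flow C t z) = z := by
  rw [flow_flow hK hM, neg_add_cancel, flow_zero hK hM]

lemma flow_flow_neg (hK : LipschitzWith K C) (hM : ∀ x, ‖C x‖ ≤ M) (t : ℝ) (z : Plane) :
    flow C t (flow C (-t) z) = z := by
  rw [flow_flow hK hM, add_neg_cancel, flow_zero hK hM]

lemma dist_trajectories_le (hK : LipschitzWith K C) {x y : Plane} {γ γ' : ℝ → Plane}
    (h : IsTrajectory C x γ) (h' : IsTrajectory C y γ') {t : ℝ} (ht : 0 ≤ t) :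
    dist (γ t) (γ' t) ≤ dist x y * Real.exp (K * t) := by
  have := dist_le_of_trajectories_ODE (v := fun _ => C) (δ := dist x y) (a := 0) (b := t)
    (fun _ => hK) (fun s _ => (h.2 s).continuousAt.continuousWithinAt)
    (fun s _ => (h.2 s).hasDerivWithinAt) (fun s _ => (h'.2 s).continuousAt.continuousWithinAt)
    (fun s _ => (h'.2 s).hasDerivWithinAt) (by rw [h.1, h'.1]) t ⟨ht, le_rfl⟩
  simpa using this

lemma IsTrajectory.comp_neg {z : Plane} {γ : ℝ → Plane} (h : IsTrajectory C z γ) :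
    IsTrajectory (fun x => -C x) z fun t => γ (-t) := by
  refine ⟨by simpa using h.1, fun t => ?_⟩
  have := (h.2 (-t)).scomp t (hasDerivAt_neg t)
  rwa [neg_one_smul] at this

lemma dist_flow_le (hK : LipschitzWith K C) (hM : ∀ x, ‖C x‖ ≤ M) (t : ℝ) (x y : Plane) :
    dist (flow C t x) (flow C t y) ≤ dist x y * Real.exp (K * |t|) := by
  have hx := isTrajectory_flow hK hM x
  have hy := isTrajectory_flow hK hM y
  rcases le_total 0 t with ht | ht
  · rw [abs_of_nonneg ht]
    exact dist_trajectories_le hK hx hy ht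
  · rw [abs_of_nonpos ht]
    simpa using dist_trajectories_le hK.neg hx.comp_neg hy.comp_neg (neg_nonneg.2 ht)

lemma lipschitzWith_flow (hK : LipschitzWith K C) (hM : ∀ x, ‖C x‖ ≤ M) (t : ℝ) :
    LipschitzWith (Real.exp (K * |t|)).toNNReal (flow C t) :=
  LipschitzWith.of_dist_le_mul fun x y => by
    rw [Real.coe_toNNReal _ (Real.exp_pos _).le, mul_comm]
    exact dist_flow_le hK hM t x y

lemma norm_flow_sub_le (hK : LipschitzWith K C) (hM : ∀ x, ‖C x‖ ≤ M) (s t : ℝ) (z : Plane) :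
    ‖flow C s z - flow C t z‖ ≤ M * |s - t| := by
  have h := (isTrajectory_flow hK hM z).2
  have := convex_univ.norm_image_sub_le_of_norm_hasDerivWithin_le (𝕜 := ℝ)
    (fun r _ => (h r).hasDerivWithinAt) (fun r _ => hM _) (Set.mem_univ t) (Set.mem_univ s)
  simpa using this

lemma continuous_flow (hK : LipschitzWith K C) (hM : ∀ x, ‖C x‖ ≤ M) :
    Continuous fun p : ℝ × Plane => flow C p.1 p.2 := by
  rw [continuous_iff_continuousAt]
  rintro ⟨s, y⟩
  rw [ContinuousAt, tendsto_iff_dist_tendsto_zero]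
  have hlim : Tendsto (fun p : ℝ × Plane => M * |p.1 - s| + dist p.2 y * Real.exp (K * |s|))
      (𝓝 (s, y)) (𝓝 0) := by
    have : Continuous fun p : ℝ × Plane => M * |p.1 - s| + dist p.2 y * Real.exp (K * |s|) := by
      fun_prop
    exact this.tendsto' _ _ (by simp)
  refine squeeze_zero (fun _ => dist_nonneg) (fun p => ?_) hlim
  refine (dist_triangle _ (flow C s p.2) _).trans (add_le_add ?_ (dist_flow_le hK hM s _ _))
  rw [dist_eq_norm]
  exact norm_flow_sub_le hK hM _ _ _

/-- Lipschitz maps distort the area at most by the square of their Lipschitz constant. -/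
lemma volume_image_le_of_lipschitzWith {L : ℝ≥0} {f : Plane → Plane} (hf : LipschitzWith L f)
    (s : Set Plane) : volume (f '' s) ≤ (L : ENNReal) ^ 2 * volume s := by
  have hrank : Module.finrank ℝ Plane = 2 := finrank_euclideanSpace_fin
  -- Two-dimensional Hausdorff measure is a Haar measure, so Lebesgue measure is a multiple of it
  -- and inherits its behaviour under Lipschitz maps.
  have hH : Measure.IsAddHaarMeasure (Measure.hausdorffMeasure (X := Plane) 2) := by
    have := isAddHaarMeasure_hausdorffMeasure (E := Plane)
    rwa [hrank] at this
  have h1 := Measure.isAddLeftInvariant_eq_smul (volume : Measure Plane)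
    (Measure.hausdorffMeasure (X := Plane) 2)
  have h2 := hf.hausdorffMeasure_image_le (d := 2) zero_le_two s
  rw [h1]
  simp only [Measure.smul_apply, Measure.nnreal_smul_coe_apply]
  rw [mul_left_comm]
  gcongr
  simpa using h2

/-- Preimages under Π(-t) are images under Π(t), which is Lipschitz with constant exp(K|t|). This
crude area bound replaces the exact Jacobian: only exponential growth is needed. -/
lemma map_flow_le (hK : LipschitzWith K C) (hM : ∀ x, ‖C x‖ ≤ M) (t : ℝ) :
    Measure.map (flow C (-t)) volume ≤
      ((Real.exp (2 * K * |t|)).toNNReal : ENNReal) • (volume : Measure Plane) := by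
  have hmeas : Measurable (flow C (-t)) := (lipschitzWith_flow hK hM (-t)).continuous.measurable
  refine Measure.le_iff.2 fun s hs => ?_
  rw [Measure.map_apply hmeas hs]
  have h1 : flow C (-t) ⁻¹' s = flow C t '' s :=
    (congrFun (Set.image_eq_preimage_of_inverse (f := flow C t) (g := flow C (-t))
      (fun x => flow_neg_flow hK hM t x) fun x => flow_flow_neg hK hM t x) s).symm
  rw [h1]
  refine (volume_image_le_of_lipschitzWith (lipschitzWith_flow hK hM t) s).trans_eq ?_
  rw [Measure.smul_apply, smul_eq_mul]
  congr 1
  rw [← ENNReal.coe_pow, ← Real.toNNReal_pow (Real.exp_pos _).le, ← Real.exp_nat_mul]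
  congr 3
  push_cast
  ring

lemma quasiMeasurePreserving_flow (hK : LipschitzWith K C) (hM : ∀ x, ‖C x‖ ≤ M) (t : ℝ) :
    Measure.QuasiMeasurePreserving (flow C (-t)) volume volume :=
  ⟨(lipschitzWith_flow hK hM (-t)).continuous.measurable,
    (Measure.absolutelyContinuous_of_le (map_flow_le hK hM t)).trans
      (Measure.smul_absolutelyContinuous)⟩

lemma integrable_comp_flow (hK : LipschitzWith K C) (hM : ∀ x, ‖C x‖ ≤ M) (t : ℝ) {u : Plane → ℝ}
    (hu : Integrable u) : Integrable fun x => u (flow C (-t) x) :=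
  (hu.of_measure_le_smul ENNReal.coe_ne_top (map_flow_le hK hM t)).comp_measurable
    (lipschitzWith_flow hK hM (-t)).continuous.measurable

lemma integral_norm_comp_flow_le (hK : LipschitzWith K C) (hM : ∀ x, ‖C x‖ ≤ M) (t : ℝ)
    {u : Plane → ℝ} (hu : Integrable u) :
    ∫ x, ‖u (flow C (-t) x)‖ ≤ Real.exp (2 * K * |t|) * ∫ x, ‖u x‖ := by
  have hmeas : Measurable (flow C (-t)) := (lipschitzWith_flow hK hM (-t)).continuous.measurable
  have hle := map_flow_le hK hM t
  have h1 := hu.of_measure_le_smul ENNReal.coe_ne_top hle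
  rw [← integral_map hmeas.aemeasurable (f := fun x => ‖u x‖) h1.norm.aestronglyMeasurable]
  refine (integral_mono_measure hle (Eventually.of_forall fun x => norm_nonneg _)
    (hu.norm.smul_measure ENNReal.coe_ne_top)).trans_eq ?_
  rw [integral_smul_measure, ENNReal.coe_toReal, Real.coe_toNNReal _ (Real.exp_pos _).le,
    smul_eq_mul]

end Flow

/-! ### The transport semigroup on L¹. -/

section Transport

/-- Bounds on a speed: Lipschitz constant, sup norm, and sup norm of the divergence. -/
structure IsBoundedSpeed (C : Plane → Plane) (K : ℝ≥0) (M D : ℝ) : Prop where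
  lipschitz : LipschitzWith K C
  norm_le : ∀ x, ‖C x‖ ≤ M
  differentiable : Differentiable ℝ C
  continuous_divergence : Continuous (divergence C)
  divergence_le : ∀ x, ‖divergence C x‖ ≤ D

lemma fderiv_eq_sum_partialDeriv (C : Plane → Plane) (x v : Plane) :
    fderiv ℝ C x v = ∑ i, v i • partialDeriv C i x := by
  have h1 : v = ∑ i, v i • EuclideanSpace.single i (1 : ℝ) := by
    ext j
    fin_cases j <;> simp
  conv_lhs => rw [h1]
  simp only [map_sum, map_smul, partialDeriv]

lemma IsAdmissibleSpeed.exists_bounds {C : Plane → Plane} (hC : IsAdmissibleSpeed C) :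
    ∃ K M D, 0 ≤ M ∧ 0 ≤ D ∧ IsBoundedSpeed C K M D := by
  obtain ⟨M, hM⟩ := hC.bounded
  choose P hP using hC.partial_bounded
  have hP0 : ∀ i, 0 ≤ P i := fun i => (norm_nonneg _).trans (hP i 0)
  have hsum : 0 ≤ ∑ i, P i := Finset.sum_nonneg fun i _ => hP0 i
  refine ⟨(∑ i, P i).toNNReal, M, ∑ i, P i, (norm_nonneg _).trans (hM 0), hsum,
    ⟨?_, hM, hC.contDiff.differentiable one_ne_zero, ?_, fun x => ?_⟩⟩
  · refine lipschitzWith_of_nnnorm_fderiv_le (𝕜 := ℝ)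
      (hC.contDiff.differentiable one_ne_zero) fun x => ?_
    rw [← NNReal.coe_le_coe, coe_nnnorm, Real.coe_toNNReal _ hsum]
    refine ContinuousLinearMap.opNorm_le_bound _ hsum fun v => ?_
    rw [fderiv_eq_sum_partialDeriv, Finset.sum_mul]
    refine (norm_sum_le _ _).trans (Finset.sum_le_sum fun i _ => ?_)
    rw [norm_smul, mul_comm]
    exact mul_le_mul (hP i x) (PiLp.norm_apply_le v i) (norm_nonneg _) (hP0 i)
  · refine continuous_finsetSum _ fun i _ => ?_
    exact (EuclideanSpace.proj (𝕜 := ℝ) i).continuous.comp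
      (hC.partial_uniformContinuous i).continuous
  · refine (norm_sum_le _ _).trans (Finset.sum_le_sum fun i _ => ?_)
    exact (PiLp.norm_apply_le _ i).trans (hP i x)

variable {C : Plane → Plane} {K : ℝ≥0} {M D : ℝ}

/-- The factor `exp (-∫₀ᵗ (∇ · C)(Π(-σ) x) dσ)`. -/
def transportFactor (C : Plane → Plane) (t : ℝ) (x : Plane) : ℝ :=
  Real.exp (-∫ σ in (0 : ℝ)..t, divergence C (flow C (-σ) x))

lemma IsBoundedSpeed.continuous_divergence_flow (h : IsBoundedSpeed C K M D) :
    Continuous fun p : ℝ × Plane => divergence C (flow C (-p.1) p.2) :=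
  h.continuous_divergence.comp ((continuous_flow h.lipschitz h.norm_le).comp
    (continuous_fst.neg.prodMk continuous_snd))

lemma IsBoundedSpeed.continuous_transportFactor (h : IsBoundedSpeed C K M D) (t : ℝ) :
    Continuous (transportFactor C t) := by
  refine Real.continuous_exp.comp (Continuous.neg ?_)
  refine intervalIntegral.continuous_parametric_intervalIntegral_of_continuous'
    (f := fun x σ => divergence C (flow C (-σ) x)) ?_ 0 t
  exact h.continuous_divergence_flow.comp continuous_swap

lemma transportFactor_pos (C : Plane → Plane) (t : ℝ) (x : Plane) : 0 < transportFactor C t x :=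
  Real.exp_pos _

lemma IsBoundedSpeed.transportFactor_le (h : IsBoundedSpeed C K M D) {t : ℝ} (ht : 0 ≤ t)
    (x : Plane) : transportFactor C t x ≤ Real.exp (D * t) := by
  refine Real.exp_le_exp.2 ((neg_le_abs _).trans ?_)
  have := intervalIntegral.norm_integral_le_of_norm_le_const (a := 0) (b := t) (C := D)
    (f := fun σ => divergence C (flow C (-σ) x)) fun σ _ => h.divergence_le _
  rwa [sub_zero, abs_of_nonneg ht] at this

/-- The transport semigroup on functions. -/
def transportFun (C : Plane → Plane) (t : ℝ) (u : Plane → ℝ) (x : Plane) : ℝ :=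
  transportFactor C t x * u (flow C (-t) x)

lemma IsBoundedSpeed.integrable_transportFun (h : IsBoundedSpeed C K M D) {t : ℝ} (ht : 0 ≤ t)
    {u : Plane → ℝ} (hu : Integrable u) : Integrable (transportFun C t u) :=
  (integrable_comp_flow h.lipschitz h.norm_le t hu).bdd_mul (c := Real.exp (D * t))
    (h.continuous_transportFactor t).aestronglyMeasurable (Eventually.of_forall fun x => by
      rw [Real.norm_of_nonneg (transportFactor_pos C t x).le]
      exact h.transportFactor_le ht x)

/-- The rate D comes from the exponential factor and 2K from the distortion of area by the flow. -/
lemma IsBoundedSpeed.integral_norm_transportFun_le (h : IsBoundedSpeed C K M D) {t : ℝ}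
    (ht : 0 ≤ t) {u : Plane → ℝ} (hu : Integrable u) :
    ∫ x, ‖transportFun C t u x‖ ≤ Real.exp ((D + 2 * K) * t) * ∫ x, ‖u x‖ := by
  have h1 := integrable_comp_flow h.lipschitz h.norm_le t hu
  calc ∫ x, ‖transportFun C t u x‖ ≤ ∫ x, Real.exp (D * t) * ‖u (flow C (-t) x)‖ := by
        refine integral_mono (h.integrable_transportFun ht hu).norm
          (h1.norm.const_mul _) fun x => ?_
        simp only [transportFun]
        rw [norm_mul, Real.norm_of_nonneg (transportFactor_pos C t x).le]
        exact mul_le_mul_of_nonneg_right (h.transportFactor_le ht x) (norm_nonneg _)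
    _ = Real.exp (D * t) * ∫ x, ‖u (flow C (-t) x)‖ := integral_const_mul _ _
    _ ≤ Real.exp (D * t) * (Real.exp (2 * K * |t|) * ∫ x, ‖u x‖) := by
        gcongr
        exact integral_norm_comp_flow_le h.lipschitz h.norm_le t hu
    _ = Real.exp ((D + 2 * K) * t) * ∫ x, ‖u x‖ := by
        rw [abs_of_nonneg ht, ← mul_assoc, ← Real.exp_add, add_mul]

lemma transportSemigroup_eq (C : Plane → Plane) (t : ℝ≥0) (u : L1) :
    transportSemigroup C t u = toL1 (transportFun C t u) := rfl

lemma IsBoundedSpeed.transportFun_congr (h : IsBoundedSpeed C K M D) (t : ℝ) {u v : Plane → ℝ}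
    (huv : u =ᵐ[volume] v) : transportFun C t u =ᵐ[volume] transportFun C t v := by
  filter_upwards [(quasiMeasurePreserving_flow h.lipschitz h.norm_le t).ae huv] with x hx
  rw [transportFun, transportFun, hx]

/-- The transport semigroup as a family of bounded operators. -/
def IsBoundedSpeed.transportCLM (h : IsBoundedSpeed C K M D) (t : ℝ≥0) : L1 →L[ℝ] L1 :=
  LinearMap.mkContinuous
    { toFun := transportSemigroup C t
      map_add' := fun u v => by
        have hu := h.integrable_transportFun t.coe_nonneg (L1.integrable_coeFn u)
        have hv := h.integrable_transportFun t.coe_nonneg (L1.integrable_coeFn v)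
        simp only [transportSemigroup_eq]
        refine (eq_toL1_of_ae ?_).symm
        filter_upwards [Lp.coeFn_add (toL1 (transportFun C t u)) (toL1 (transportFun C t v)),
          coeFn_toL1 hu, coeFn_toL1 hv, h.transportFun_congr t (Lp.coeFn_add u v)]
          with x h1 h2 h3 h4
        rw [h1, Pi.add_apply, h2, h3, h4]
        simp only [transportFun, Pi.add_apply, mul_add]
      map_smul' := fun c u => by
        have hu := h.integrable_transportFun t.coe_nonneg (L1.integrable_coeFn u)
        simp only [transportSemigroup_eq, RingHom.id_apply]
        refine (eq_toL1_of_ae ?_).symm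
        filter_upwards [Lp.coeFn_smul c (toL1 (transportFun C t u)),
          coeFn_toL1 hu, h.transportFun_congr t (Lp.coeFn_smul c u)] with x h1 h2 h3
        rw [h1, Pi.smul_apply, h2, h3]
        simp only [transportFun, Pi.smul_apply, smul_eq_mul]
        ring }
    (Real.exp ((D + 2 * K) * t)) fun u => by
      have hu := L1.integrable_coeFn u
      simp only [LinearMap.coe_mk, AddHom.coe_mk, transportSemigroup_eq]
      rw [norm_toL1 (h.integrable_transportFun t.coe_nonneg hu), L1.norm_eq_integral_norm]
      exact h.integral_norm_transportFun_le t.coe_nonneg hu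

lemma IsBoundedSpeed.transportCLM_apply (h : IsBoundedSpeed C K M D) (t : ℝ≥0) (u : L1) :
    h.transportCLM t u = transportSemigroup C t u := rfl

lemma IsBoundedSpeed.norm_transportCLM_le (h : IsBoundedSpeed C K M D) (t : ℝ≥0) (u : L1) :
    ‖h.transportCLM t u‖ ≤ Real.exp ((D + 2 * K) * t) * ‖u‖ :=
  ContinuousLinearMap.le_of_opNorm_le _
    (LinearMap.mkContinuous_norm_le _ (Real.exp_pos _).le _) u

lemma IsBoundedSpeed.transportCLM_toL1 (h : IsBoundedSpeed C K M D) (t : ℝ≥0) {f : Plane → ℝ}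
    (hf : Integrable f) : h.transportCLM t (toL1 f) = toL1 (transportFun C t f) := by
  rw [h.transportCLM_apply, transportSemigroup_eq]
  exact toL1_congr (h.transportFun_congr t (coeFn_toL1 hf))

lemma IsBoundedSpeed.convectionOp_eq (h : IsBoundedSpeed C K M D) :
    convectionOp C = generator fun t u => h.transportCLM t u := rfl

end Transport

/-! ### Convection acting on a heat kernel. -/

section KernelEstimates

variable {ε t : ℝ}

lemma hasFDerivAt_heatKernel (ε t : ℝ) (z x : Plane) :
    HasFDerivAt (fun x => heatKernel ε t (x - z))
      ((-(2 / (4 * ε ^ 2 * t)) * heatKernel ε t (x - z)) • innerSL ℝ (x - z)) x := by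
  have h1 : HasFDerivAt (fun x : Plane => ‖x - z‖ ^ 2) (2 • innerSL ℝ (x - z)) x := by
    simpa using ((hasFDerivAt_id x).sub_const z).norm_sq
  have h2 := ((h1.neg.mul_const (4 * ε ^ 2 * t)⁻¹).exp).const_mul (1 / (4 * Real.pi * ε ^ 2 * t))
  convert! h2 using 1
  ext v
  simp only [heatKernel, div_eq_mul_inv, smul_apply, neg_apply, smul_eq_mul, nsmul_eq_mul,
    Pi.neg_apply]
  push_cast
  ring

/-- `-∇ · (k C)` for the heat kernel `k` centred at `z`. -/
def kernelFlux (ε t : ℝ) (C : Plane → Plane) (z x : Plane) : ℝ :=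
  -divergence C x * heatKernel ε t (x - z) +
    2 / (4 * ε ^ 2 * t) * heatKernel ε t (x - z) * inner ℝ (x - z) (C x)

lemma heatKernel_le_two_mul (hε : 0 < ε) (ht : 0 < t) (x : Plane) :
    heatKernel ε t x ≤ 2 * heatKernel ε (2 * t) x := by
  have h1 : Real.exp (-‖x‖ ^ 2 / (4 * ε ^ 2 * t)) ≤
      Real.exp (-‖x‖ ^ 2 / (4 * ε ^ 2 * (2 * t))) := by
    refine Real.exp_le_exp.2 ?_
    rw [neg_div, neg_div, neg_le_neg_iff]
    gcongr
    linarith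
  have hpi := Real.pi_pos
  have h2 : 2 * heatKernel ε (2 * t) x =
      1 / (4 * Real.pi * ε ^ 2 * t) * Real.exp (-‖x‖ ^ 2 / (4 * ε ^ 2 * (2 * t))) := by
    rw [heatKernel]
    field_simp
  rw [h2, heatKernel]
  gcongr

/-- Half of the Gaussian exponent absorbs the linear factor, through r·exp(-r²/2) ≤ 1 for the
rescaled length r; the other half is the kernel at time 2t. -/
lemma norm_mul_heatKernel_le (hε : 0 < ε) (ht : 0 < t) (x : Plane) :
    2 / (4 * ε ^ 2 * t) * heatKernel ε t x * ‖x‖ ≤ 2 / (ε * √t) * heatKernel ε (2 * t) x := by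
  have hs : 0 < √t := Real.sqrt_pos.2 ht
  have hst : √t ^ 2 = t := Real.sq_sqrt ht.le
  have hpi := Real.pi_pos
  set r := ‖x‖ / (2 * ε * √t) with hr
  have hr0 : 0 ≤ r := by positivity
  have hx : ‖x‖ = r * (2 * ε * √t) := by rw [hr]; field_simp
  have h1 : r * Real.exp (-(r ^ 2) / 2) ≤ 1 := by
    have h2 := Real.add_one_le_exp (r ^ 2 / 2)
    rw [neg_div, Real.exp_neg, ← div_eq_mul_inv, div_le_one (Real.exp_pos _)]
    nlinarith [sq_nonneg (r - 1)]
  have e1 : heatKernel ε t x = 1 / (4 * Real.pi * ε ^ 2 * t) *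
      (Real.exp (-(r ^ 2) / 2) * Real.exp (-(r ^ 2) / 2)) := by
    rw [heatKernel, ← Real.exp_add, hx]
    congr 2
    rw [mul_pow, mul_pow, hst]
    field_simp
    ring
  have e2 : heatKernel ε (2 * t) x = 1 / (4 * Real.pi * ε ^ 2 * (2 * t)) *
      Real.exp (-(r ^ 2) / 2) := by
    rw [heatKernel, hx]
    congr 2
    rw [mul_pow, mul_pow, hst]
    field_simp
    ring
  have e3 : 2 / (4 * ε ^ 2 * t) * heatKernel ε t x * ‖x‖ =
      (2 / (ε * √t) * heatKernel ε (2 * t) x) * (r * Real.exp (-(r ^ 2) / 2)) := by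
    rw [e1, e2, hx]
    nth_rewrite 1 [← hst]
    field_simp
    ring
  rw [e3]
  have h3 := heatKernel_pos hε (by positivity : 0 < 2 * t) x
  exact mul_le_of_le_one_right (by positivity) h1

/-- From ‖x‖² ≤ 2‖y‖² + 2‖y - x‖²: doubling the time pays for moving the base point. -/
lemma heatKernel_le_of_near (hε : 0 < ε) (ht : 0 < t) (x y : Plane) :
    heatKernel ε t y ≤
      2 * Real.exp (‖y - x‖ ^ 2 / (4 * ε ^ 2 * t)) * heatKernel ε (2 * t) x := by
  have hpi := Real.pi_pos
  have h1 : ‖x‖ ^ 2 ≤ 2 * ‖y‖ ^ 2 + 2 * ‖y - x‖ ^ 2 := by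
    have h2 : ‖x‖ ≤ ‖y‖ + ‖y - x‖ := by
      have := norm_sub_le y (y - x)
      rwa [sub_sub_cancel] at this
    nlinarith [norm_nonneg x, norm_nonneg y, norm_nonneg (y - x), sq_nonneg (‖y‖ - ‖y - x‖)]
  have h2 : Real.exp (-‖y‖ ^ 2 / (4 * ε ^ 2 * t)) ≤
      Real.exp (‖y - x‖ ^ 2 / (4 * ε ^ 2 * t)) * Real.exp (-‖x‖ ^ 2 / (4 * ε ^ 2 * (2 * t))) := by
    rw [← Real.exp_add]
    refine Real.exp_le_exp.2 ?_
    have h3 : ‖y - x‖ ^ 2 / (4 * ε ^ 2 * t) + -‖x‖ ^ 2 / (4 * ε ^ 2 * (2 * t)) =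
        (2 * ‖y - x‖ ^ 2 - ‖x‖ ^ 2) / 2 / (4 * ε ^ 2 * t) := by
      field_simp
      ring
    rw [h3]
    gcongr
    linarith
  have h4 : 2 * Real.exp (‖y - x‖ ^ 2 / (4 * ε ^ 2 * t)) * heatKernel ε (2 * t) x =
      1 / (4 * Real.pi * ε ^ 2 * t) * (Real.exp (‖y - x‖ ^ 2 / (4 * ε ^ 2 * t)) *
        Real.exp (-‖x‖ ^ 2 / (4 * ε ^ 2 * (2 * t)))) := by
    rw [heatKernel]
    field_simp
  rw [h4, heatKernel]
  gcongr

variable {C : Plane → Plane} {K : ℝ≥0} {M D : ℝ}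

lemma IsBoundedSpeed.norm_kernelFlux_le (h : IsBoundedSpeed C K M D) (hM : 0 ≤ M) (hε : 0 < ε)
    (ht : 0 < t) (z x : Plane) :
    ‖kernelFlux ε t C z x‖ ≤ 2 * (D + M / (ε * √t)) * heatKernel ε (2 * t) (x - z) := by
  have hk := (heatKernel_pos hε ht (x - z)).le
  have hD := (norm_nonneg _).trans (h.divergence_le x)
  have h1 : ‖-divergence C x * heatKernel ε t (x - z)‖ ≤
      D * (2 * heatKernel ε (2 * t) (x - z)) := by
    rw [norm_mul, norm_neg, Real.norm_of_nonneg hk]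
    exact mul_le_mul (h.divergence_le x) (heatKernel_le_two_mul hε ht _) hk hD
  have h2 : ‖2 / (4 * ε ^ 2 * t) * heatKernel ε t (x - z) * inner ℝ (x - z) (C x)‖ ≤
      (2 / (ε * √t) * heatKernel ε (2 * t) (x - z)) * M := by
    have h3 : 0 ≤ 2 / (4 * ε ^ 2 * t) * heatKernel ε t (x - z) := by positivity
    rw [norm_mul, Real.norm_of_nonneg h3]
    calc _ ≤ 2 / (4 * ε ^ 2 * t) * heatKernel ε t (x - z) * (‖x - z‖ * M) := by
          gcongr
          exact (norm_inner_le_norm _ _).trans (by gcongr; exact h.norm_le x)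
      _ = (2 / (4 * ε ^ 2 * t) * heatKernel ε t (x - z) * ‖x - z‖) * M := by ring
      _ ≤ _ := mul_le_mul_of_nonneg_right (norm_mul_heatKernel_le hε ht _) hM
  refine (norm_add_le _ _).trans ((add_le_add h1 h2).trans_eq ?_)
  ring

lemma IsBoundedSpeed.continuous_kernelFlux (h : IsBoundedSpeed C K M D) (ε t : ℝ) (z : Plane) :
    Continuous (kernelFlux ε t C z) := by
  have h1 := h.continuous_divergence
  have h2 := h.lipschitz.continuous
  have h3 := (continuous_heatKernel ε t).comp (continuous_id.sub continuous_const : Continuous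
    fun x : Plane => x - z)
  exact (h1.neg.mul h3).add ((continuous_const.mul h3).mul
    ((continuous_id.sub continuous_const).inner h2))

lemma IsBoundedSpeed.integrable_kernelFlux (h : IsBoundedSpeed C K M D) (hM : 0 ≤ M) (hε : 0 < ε)
    (ht : 0 < t) (z : Plane) : Integrable (kernelFlux ε t C z) :=
  (((integrable_heatKernel hε (by positivity : 0 < 2 * t)).comp_sub_right z).const_mul _).mono'
    (h.continuous_kernelFlux ε t z).aestronglyMeasurable
    (Eventually.of_forall fun x => h.norm_kernelFlux_le hM hε ht z x)

/-- The pointwise form of (d/ds)T_B(s)k = T_B(s)Bk. Time enters only through the factor and the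
point Π(-s)x, so no space derivative of the flow is needed. -/
lemma IsBoundedSpeed.hasDerivAt_transportFun_heatKernel (h : IsBoundedSpeed C K M D) (ε t : ℝ)
    (z x : Plane) (s : ℝ) :
    HasDerivAt (fun s => transportFun C s (fun x => heatKernel ε t (x - z)) x)
      (transportFun C s (kernelFlux ε t C z) x) s := by
  have hc : Continuous fun σ : ℝ => divergence C (flow C (-σ) x) :=
    h.continuous_divergence_flow.comp (continuous_id.prodMk continuous_const)
  have h1 : HasDerivAt (fun s => transportFactor C s x)
      (transportFactor C s x * -divergence C (flow C (-s) x)) s :=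
    ((hc.integral_hasStrictDerivAt 0 s).hasDerivAt.neg).exp
  have h2 : HasDerivAt (fun s => flow C (-s) x) (-C (flow C (-s) x)) s := by
    have := ((isTrajectory_flow h.lipschitz h.norm_le x).2 (-s)).scomp s (hasDerivAt_neg s)
    rwa [neg_one_smul] at this
  have h3 := (hasFDerivAt_heatKernel ε t z (flow C (-s) x)).comp_hasDerivAt s h2
  convert! h1.mul h3 using 1
  simp only [transportFun, kernelFlux, Function.comp_apply, smul_apply, map_neg,
    innerSL_apply_apply, smul_eq_mul]
  ring

/-- The constant in the uniform estimate of difference quotients. -/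
def quotientConst (ε M D : ℝ) : ℝ := Real.exp D * (2 * Real.exp (M ^ 2 / (8 * ε ^ 2)))

/-- For s ≤ √t a characteristic moves by at most M√t, the diffusive length scale, so the Gaussian at
the displaced point is controlled by the one at x with a constant free of t. Time is doubled twice,
hence 4t. -/
lemma IsBoundedSpeed.norm_transportFun_kernelFlux_le (h : IsBoundedSpeed C K M D) (hM : 0 ≤ M)
    (hD : 0 ≤ D) (hε : 0 < ε) (ht : 0 < t) {s : ℝ} (hs0 : 0 ≤ s) (hs1 : s ≤ 1) (hst : s ≤ √t)
    (z x : Plane) :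
    ‖transportFun C s (kernelFlux ε t C z) x‖ ≤ quotientConst ε M D *
      (2 * (D + M / (ε * √t))) * heatKernel ε (4 * t) (x - z) := by
  have h1 : transportFactor C s x ≤ Real.exp D :=
    (h.transportFactor_le hs0 x).trans (Real.exp_le_exp.2 (mul_le_of_le_one_right hD hs1))
  have h2 := h.norm_kernelFlux_le hM hε ht z (flow C (-s) x)
  have h3 := heatKernel_le_of_near hε (by positivity : 0 < 2 * t) (x - z) (flow C (-s) x - z)
  rw [sub_sub_sub_cancel_right] at h3
  have h4 : ‖flow C (-s) x - x‖ ^ 2 ≤ M ^ 2 * t := by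
    have h5 := norm_flow_sub_le h.lipschitz h.norm_le (-s) 0 x
    rw [flow_zero h.lipschitz h.norm_le, sub_zero, abs_neg, abs_of_nonneg hs0] at h5
    calc ‖flow C (-s) x - x‖ ^ 2 ≤ (M * √t) ^ 2 := by
          gcongr
          exact h5.trans (by gcongr)
      _ = M ^ 2 * t := by rw [mul_pow, Real.sq_sqrt ht.le]
  have h6 : Real.exp (‖flow C (-s) x - x‖ ^ 2 / (4 * ε ^ 2 * (2 * t))) ≤
      Real.exp (M ^ 2 / (8 * ε ^ 2)) := by
    refine Real.exp_le_exp.2 ?_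
    calc _ ≤ M ^ 2 * t / (4 * ε ^ 2 * (2 * t)) := by gcongr
      _ = M ^ 2 / (8 * ε ^ 2) := by field_simp; ring
  have h7 : 0 ≤ D + M / (ε * √t) := by positivity
  have h8 := (heatKernel_pos hε (by positivity : 0 < 4 * t) (x - z)).le
  have h9 : 2 * (2 * t) = 4 * t := by ring
  rw [h9] at h3
  rw [transportFun, norm_mul, Real.norm_of_nonneg (transportFactor_pos C s x).le]
  calc transportFactor C s x * ‖kernelFlux ε t C z (flow C (-s) x)‖
      ≤ Real.exp D * (2 * (D + M / (ε * √t)) *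
        (2 * Real.exp (M ^ 2 / (8 * ε ^ 2)) * heatKernel ε (4 * t) (x - z))) := by
        gcongr
        refine h2.trans ?_
        gcongr
        refine h3.trans ?_
        gcongr
    _ = _ := by rw [quotientConst]; ring

lemma transportFun_zero (h : IsBoundedSpeed C K M D) (u : Plane → ℝ) (x : Plane) :
    transportFun C 0 u x = u x := by
  simp [transportFun, transportFactor, flow_zero h.lipschitz h.norm_le]

lemma IsBoundedSpeed.norm_transportFun_sub_le (h : IsBoundedSpeed C K M D) (hM : 0 ≤ M)
    (hD : 0 ≤ D) (hε : 0 < ε) (ht : 0 < t) {s : ℝ} (hs0 : 0 ≤ s) (hs1 : s ≤ 1) (hst : s ≤ √t)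
    (z x : Plane) :
    ‖transportFun C s (fun x => heatKernel ε t (x - z)) x - heatKernel ε t (x - z)‖ ≤
      quotientConst ε M D * (2 * (D + M / (ε * √t))) * heatKernel ε (4 * t) (x - z) * s := by
  have := norm_image_sub_le_of_norm_deriv_le_segment' (a := 0) (b := s)
    (fun r _ => (h.hasDerivAt_transportFun_heatKernel ε t z x r).hasDerivWithinAt)
    (fun r hr => h.norm_transportFun_kernelFlux_le hM hD hε ht hr.1 (hr.2.le.trans hs1)
      (hr.2.le.trans hst) z x) s ⟨hs0, le_rfl⟩
  rwa [transportFun_zero h, sub_zero] at this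

/-- The flux is minus the sum of the ∂ᵢ(k Cᵢ). Integration by parts on the whole plane has no
boundary term, since the products involved are integrable. -/
lemma IsBoundedSpeed.integral_kernelFlux (h : IsBoundedSpeed C K M D) (hε : 0 < ε)
    (ht : 0 < t) (z : Plane) : ∫ x, kernelFlux ε t C z x = 0 := by
  set f : Plane → ℝ := fun x => heatKernel ε t (x - z) with hf
  have hfd : ∀ x, HasFDerivAt f
      ((-(2 / (4 * ε ^ 2 * t)) * heatKernel ε t (x - z)) • innerSL ℝ (x - z)) x :=
    fun x => hasFDerivAt_heatKernel ε t z x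
  have hfi : Integrable f := (integrable_heatKernel hε ht).comp_sub_right z
  have hgd : ∀ (i : Fin 2) x, HasFDerivAt (fun x => C x i)
      ((EuclideanSpace.proj (𝕜 := ℝ) i).comp (fderiv ℝ C x)) x := fun i x =>
    (EuclideanSpace.proj (𝕜 := ℝ) i).hasFDerivAt.comp x (h.differentiable x).hasFDerivAt
  have hgb : ∀ i x, ‖C x i‖ ≤ M := fun i x => (PiLp.norm_apply_le _ i).trans (h.norm_le x)
  have hgc : ∀ i : Fin 2, Continuous fun x => C x i := fun i =>
    (EuclideanSpace.proj (𝕜 := ℝ) i).continuous.comp h.lipschitz.continuous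
  have i1 : ∀ i : Fin 2, Integrable fun x => fderiv ℝ f x (EuclideanSpace.single i 1) * C x i := by
    intro i
    have h2 := ((integrable_heatKernel hε (by positivity : 0 < 2 * t)).comp_sub_right z).const_mul
      (2 / (ε * √t))
    refine (h2.mul_const M).mono' ?_ (Eventually.of_forall fun x => ?_)
    · exact ((measurable_fderiv_apply_const ℝ f _).mul (hgc i).measurable).aestronglyMeasurable
    · rw [norm_mul]
      have hk := (heatKernel_pos hε (by positivity : 0 < 2 * t) (x - z)).le
      refine mul_le_mul ?_ (hgb i x) (norm_nonneg _) (by positivity)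
      refine le_trans ?_ (norm_mul_heatKernel_le hε ht (x - z))
      have hk' := (heatKernel_pos hε ht (x - z)).le
      rw [(hfd x).fderiv, smul_apply, norm_smul, norm_mul, norm_neg, Real.norm_of_nonneg hk',
        Real.norm_of_nonneg (by positivity)]
      gcongr
      rw [innerSL_apply_apply]
      exact (norm_inner_le_norm (𝕜 := ℝ) (x - z) _).trans_eq (by simp)
  have i2 : ∀ i : Fin 2, Integrable fun x =>
      f x * fderiv ℝ (fun x => C x i) x (EuclideanSpace.single i 1) := by
    intro i
    refine (hfi.mul_const K).mono' ?_ (Eventually.of_forall fun x => ?_)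
    · exact hfi.aestronglyMeasurable.mul
        (measurable_fderiv_apply_const ℝ (fun x => C x i) _).aestronglyMeasurable
    · rw [norm_mul, Real.norm_of_nonneg (heatKernel_pos hε ht _).le, (hgd i x).fderiv]
      refine mul_le_mul_of_nonneg_left ?_ (heatKernel_pos hε ht _).le
      refine (PiLp.norm_apply_le _ i).trans ?_
      refine (ContinuousLinearMap.le_of_opNorm_le _ (norm_fderiv_le_of_lipschitz ℝ h.lipschitz)
        _).trans_eq ?_
      simp
  have i3 : ∀ i : Fin 2, Integrable fun x => f x * C x i := by
    intro i
    refine (hfi.mul_const M).mono' ?_ (Eventually.of_forall fun x => ?_)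
    · exact hfi.aestronglyMeasurable.mul (hgc i).aestronglyMeasurable
    · rw [norm_mul, Real.norm_of_nonneg (heatKernel_pos hε ht _).le]
      gcongr
      · exact (heatKernel_pos hε ht _).le
      · exact hgb i x
  have hparts : ∀ i : Fin 2, ∫ x, (f x * fderiv ℝ (fun x => C x i) x (EuclideanSpace.single i 1) +
      fderiv ℝ f x (EuclideanSpace.single i 1) * C x i) = 0 := by
    intro i
    rw [integral_add (i2 i) (i1 i), integral_mul_fderiv_eq_neg_fderiv_mul_of_integrable (i1 i)
      (i2 i) (i3 i) (fun x _ => (hfd x).differentiableAt) fun x _ => (hgd i x).differentiableAt,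
      neg_add_cancel]
  have hflux : ∀ x, kernelFlux ε t C z x = -∑ i : Fin 2,
      (f x * fderiv ℝ (fun x => C x i) x (EuclideanSpace.single i 1) +
        fderiv ℝ f x (EuclideanSpace.single i 1) * C x i) := by
    intro x
    have e1 : ∀ (i : Fin 2) v, fderiv ℝ (fun x => C x i) x v = (fderiv ℝ C x v) i := fun i v => by
      rw [(hgd i x).fderiv]
      rfl
    have e2 : ∀ v, fderiv ℝ f x v =
        -(2 / (4 * ε ^ 2 * t)) * heatKernel ε t (x - z) * inner ℝ (x - z) v := fun v => by
      rw [(hfd x).fderiv]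
      rfl
    have e3 : ∀ i : Fin 2, inner ℝ (x - z) (EuclideanSpace.single i (1 : ℝ)) = (x - z) i :=
      fun i => by
        rw [EuclideanSpace.inner_single_right]
        simp
    simp only [e1, e2, e3, kernelFlux, divergence, Fin.sum_univ_two, partialDeriv]
    simp only [hf]
    rw [PiLp.inner_apply, Fin.sum_univ_two]
    simp only [RCLike.inner_apply, conj_trivial]
    ring
  simp_rw [hflux]
  rw [integral_neg, neg_eq_zero]
  exact (integral_finsetSum _ fun i _ => (i2 i).add (i1 i)).trans
    (Finset.sum_eq_zero fun i _ => hparts i)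

end KernelEstimates

/-! ### The bound on B(l - A)⁻¹. -/

section RelativeBound

/-- Dominated convergence in `L¹`. -/
lemma tendsto_toL1 {ι : Type*} {l : Filter ι} [l.IsCountablyGenerated] {F : ι → Plane → ℝ}
    {f g : Plane → ℝ} (hF : ∀ᶠ n in l, Integrable (F n)) (hf : Integrable f) (hg : Integrable g)
    (hb : ∀ᶠ n in l, ∀ x, ‖F n x‖ ≤ g x) (hlim : ∀ x, Tendsto (fun n => F n x) l (𝓝 (f x))) :
    Tendsto (fun n => toL1 (F n)) l (𝓝 (toL1 f)) := by
  rw [tendsto_iff_norm_sub_tendsto_zero]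
  have h1 : Tendsto (fun n => ∫ x, ‖F n x - f x‖) l (𝓝 (∫ _ : Plane, (0 : ℝ))) := by
    refine tendsto_integral_filter_of_dominated_convergence (fun x => g x + ‖f x‖) ?_ ?_
      (hg.add hf.norm) ?_
    · filter_upwards [hF] with n hn
      exact (hn.sub hf).norm.aestronglyMeasurable
    · filter_upwards [hb] with n hn
      refine Eventually.of_forall fun x => ?_
      rw [norm_norm]
      exact (norm_sub_le _ _).trans (add_le_add_left (hn x) _)
    · exact Eventually.of_forall fun x =>
        (tendsto_iff_norm_sub_tendsto_zero.1 (hlim x))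
  rw [integral_zero] at h1
  refine h1.congr' ?_
  filter_upwards [hF] with n hn
  rw [toL1_of_integrable hn, toL1_of_integrable hf, ← Integrable.toL1_sub,
    L1.norm_of_fun_eq_integral_norm]
  rfl

variable {C : Plane → Plane} {K : ℝ≥0} {M D ε : ℝ}

/-- Difference quotients of the transport semigroup. -/
def IsBoundedSpeed.quotient (h : IsBoundedSpeed C K M D) (τ : ℝ≥0) : L1 →L[ℝ] L1 :=
  (τ : ℝ)⁻¹ • (h.transportCLM τ - ContinuousLinearMap.id ℝ L1)

lemma IsBoundedSpeed.quotient_apply (h : IsBoundedSpeed C K M D) (τ : ℝ≥0) (u : L1) :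
    h.quotient τ u = (τ : ℝ)⁻¹ • (h.transportCLM τ u - u) := rfl

lemma IsBoundedSpeed.integrable_quotient (h : IsBoundedSpeed C K M D) (τ : ℝ≥0) {f : Plane → ℝ}
    (hf : Integrable f) : Integrable fun x => (τ : ℝ)⁻¹ * (transportFun C τ f x - f x) :=
  ((h.integrable_transportFun τ.coe_nonneg hf).sub hf).const_mul _

lemma IsBoundedSpeed.quotient_toL1 (h : IsBoundedSpeed C K M D) (τ : ℝ≥0) {f : Plane → ℝ}
    (hf : Integrable f) :
    h.quotient τ (toL1 f) = toL1 fun x => (τ : ℝ)⁻¹ * (transportFun C τ f x - f x) := by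
  have h1 := h.integrable_transportFun τ.coe_nonneg hf
  rw [h.quotient_apply, h.transportCLM_toL1 τ hf, toL1_of_integrable hf, toL1_of_integrable h1,
    ← Integrable.toL1_sub, ← Integrable.toL1_smul, toL1_of_integrable (h.integrable_quotient τ hf)]
  rfl

/-- The exponent-zero coefficient of the uniform bound for difference quotients. -/
def regularCoeff (ε M D : ℝ) : ℝ := quotientConst ε M D * (2 * D)

/-- The coefficient of `1 / √t` of the uniform bound for difference quotients. -/
def singularCoeff (ε : ℝ) (K : ℝ≥0) (M D : ℝ) : ℝ :=
  quotientConst ε M D * (2 * (M / ε)) + (Real.exp (D + 2 * K) + 1)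

lemma quotientConst_nonneg (ε M D : ℝ) : 0 ≤ quotientConst ε M D := by
  unfold quotientConst
  positivity

lemma regularCoeff_nonneg (hD : 0 ≤ D) : 0 ≤ regularCoeff ε M D :=
  mul_nonneg (quotientConst_nonneg _ _ _) (by positivity)

/-- The uniform bound for difference quotients of the transport semigroup along the heat kernel. -/
def quotientBound (ε : ℝ) (K : ℝ≥0) (M D t : ℝ) : ℝ :=
  regularCoeff ε M D + singularCoeff ε K M D / √t

lemma IsBoundedSpeed.norm_quotient_heatKernelAt_le (h : IsBoundedSpeed C K M D) (hM : 0 ≤ M)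
    (hD : 0 ≤ D) (hε : 0 < ε) {t : ℝ} (ht : 0 < t) {τ : ℝ≥0} (hτ0 : 0 < τ) (hτ1 : τ ≤ 1)
    (z : Plane) : ‖h.quotient τ (heatKernelAt ε t z)‖ ≤ quotientBound ε K M D t := by
  have hs : 0 < √t := Real.sqrt_pos.2 ht
  have hτ : (0 : ℝ) < τ := hτ0
  have hτ1' : (τ : ℝ) ≤ 1 := hτ1
  have hq := quotientConst_nonneg ε M D
  have e : quotientBound ε K M D t = quotientConst ε M D * (2 * (D + M / (ε * √t))) +
      (Real.exp (D + 2 * K) + 1) / √t := by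
    rw [quotientBound, regularCoeff, singularCoeff]
    field_simp
    ring
  rw [e]
  -- Short steps use the mean value estimate along characteristics. For τ > √t the trivial bound
  -- (‖T_B(τ)k‖ + ‖k‖)/τ is already of order 1/√t.
  rcases le_or_gt (τ : ℝ) √t with hle | hlt
  · have hk := (integrable_heatKernel hε ht).comp_sub_right z
    have h4 : (0 : ℝ) < 4 * t := by positivity
    rw [heatKernelAt, h.quotient_toL1 τ hk, norm_toL1 (h.integrable_quotient τ hk)]
    calc _ ≤ ∫ x, quotientConst ε M D * (2 * (D + M / (ε * √t))) *
            heatKernel ε (4 * t) (x - z) := by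
          refine integral_mono (h.integrable_quotient τ hk).norm
            (((integrable_heatKernel hε h4).comp_sub_right z).const_mul _) fun x => ?_
          simp only
          rw [norm_mul, norm_inv, Real.norm_of_nonneg hτ.le, inv_mul_le_iff₀ hτ, mul_comm]
          exact h.norm_transportFun_sub_le hM hD hε ht hτ.le hτ1' hle z x
      _ = quotientConst ε M D * (2 * (D + M / (ε * √t))) := by
          rw [integral_const_mul, integral_sub_right_eq_self (heatKernel ε (4 * t)) z,
            integral_heatKernel hε h4, mul_one]
      _ ≤ _ := le_add_of_nonneg_right (by positivity)
  · have h1 : Real.exp ((D + 2 * K) * τ) ≤ Real.exp (D + 2 * K) :=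
      Real.exp_le_exp.2 (mul_le_of_le_one_right (by positivity) hτ1')
    have h2 := h.norm_transportCLM_le τ (heatKernelAt ε t z)
    rw [norm_heatKernelAt hε ht, mul_one] at h2
    have h3 := norm_sub_le (h.transportCLM τ (heatKernelAt ε t z)) (heatKernelAt ε t z)
    rw [norm_heatKernelAt hε ht] at h3
    rw [h.quotient_apply, norm_smul, norm_inv, Real.norm_of_nonneg hτ.le]
    calc (τ : ℝ)⁻¹ * ‖h.transportCLM τ (heatKernelAt ε t z) - heatKernelAt ε t z‖
        ≤ (√t)⁻¹ * (Real.exp (D + 2 * K) + 1) := by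
          gcongr
          linarith
      _ = (Real.exp (D + 2 * K) + 1) / √t := by rw [div_eq_inv_mul]
      _ ≤ _ := le_add_of_nonneg_left (by positivity)

lemma eventually_pos_le {r : ℝ≥0} (hr : 0 < r) : ∀ᶠ τ : ℝ≥0 in 𝓝[>] 0, 0 < τ ∧ τ ≤ r := by
  filter_upwards [Ioc_mem_nhdsGT hr] with τ hτ using hτ

/-- Pointwise convergence is the derivative at s = 0, and for τ ≤ min(1, √t) a fixed multiple of the
kernel at time 4t dominates. -/
lemma IsBoundedSpeed.tendsto_quotient_heatKernelAt (h : IsBoundedSpeed C K M D) (hM : 0 ≤ M)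
    (hD : 0 ≤ D) (hε : 0 < ε) {t : ℝ} (ht : 0 < t) (z : Plane) :
    Tendsto (fun τ => h.quotient τ (heatKernelAt ε t z)) (𝓝[>] 0)
      (𝓝 (toL1 (kernelFlux ε t C z))) := by
  have hk := (integrable_heatKernel hε ht).comp_sub_right z
  have h4 : (0 : ℝ) < 4 * t := by positivity
  have hs : 0 < √t := Real.sqrt_pos.2 ht
  simp only [heatKernelAt, h.quotient_toL1 _ hk]
  refine tendsto_toL1 (Eventually.of_forall fun τ => h.integrable_quotient τ hk)
    (h.integrable_kernelFlux hM hε ht z)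
    (((integrable_heatKernel hε h4).comp_sub_right z).const_mul
      (quotientConst ε M D * (2 * (D + M / (ε * √t))))) ?_ fun x => ?_
  · filter_upwards [eventually_pos_le (r := min 1 (√t).toNNReal)
      (lt_min one_pos (Real.toNNReal_pos.2 hs))] with τ hτ x
    have hτ0 : (0 : ℝ) < τ := hτ.1
    have hτ1 : (τ : ℝ) ≤ 1 := hτ.2.trans (min_le_left _ _)
    have hτ2 : (τ : ℝ) ≤ √t := (Real.le_toNNReal_iff_coe_le hs.le).1 (hτ.2.trans (min_le_right _ _))
    rw [norm_mul, norm_inv, Real.norm_of_nonneg hτ0.le, inv_mul_le_iff₀ hτ0, mul_comm]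
    exact h.norm_transportFun_sub_le hM hD hε ht hτ0.le hτ1 hτ2 z x
  · have h1 := tendsto_slope_nnreal (h.hasDerivAt_transportFun_heatKernel ε t z x 0)
    simpa only [zero_add, transportFun_zero h, smul_eq_mul] using h1

/-- The operator `B T_A(t)`. -/
def fluxHeat (ε : ℝ) (C : Plane → Plane) (t : ℝ) (u : L1) : L1 :=
  ∫ z, u z • toL1 (kernelFlux ε t C z)

lemma IsBoundedSpeed.quotient_heatCLM (h : IsBoundedSpeed C K M D) (hε : 0 < ε) {t : ℝ≥0}
    (ht : 0 < t) (τ : ℝ≥0) (u : L1) :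
    h.quotient τ (heatCLM hε t u) = ∫ z, u z • h.quotient τ (heatKernelAt ε t z) := by
  rw [heatCLM_eq_integral_heatKernelAt hε ht]
  refine ((h.quotient τ).integral_comp_comm
    (integrable_smul_heatKernelAt hε (NNReal.coe_pos.2 ht) u)).symm.trans ?_
  simp only [map_smul]

lemma IsBoundedSpeed.norm_quotient_heatCLM_le (h : IsBoundedSpeed C K M D) (hM : 0 ≤ M)
    (hD : 0 ≤ D) (hε : 0 < ε) {t : ℝ≥0} (ht : 0 < t) {τ : ℝ≥0} (hτ0 : 0 < τ) (hτ1 : τ ≤ 1)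
    (u : L1) : ‖h.quotient τ (heatCLM hε t u)‖ ≤ quotientBound ε K M D t * ‖u‖ := by
  rw [h.quotient_heatCLM hε ht, L1.norm_eq_integral_norm u, ← integral_const_mul]
  refine norm_integral_le_of_norm_le ((L1.integrable_coeFn u).norm.const_mul _)
    (Eventually.of_forall fun z => ?_)
  rw [norm_smul, mul_comm]
  gcongr
  exact h.norm_quotient_heatKernelAt_le hM hD hε ht hτ0 hτ1 z

lemma IsBoundedSpeed.tendsto_quotient_heatCLM (h : IsBoundedSpeed C K M D) (hM : 0 ≤ M)
    (hD : 0 ≤ D) (hε : 0 < ε) {t : ℝ≥0} (ht : 0 < t) (u : L1) :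
    Tendsto (fun τ => h.quotient τ (heatCLM hε t u)) (𝓝[>] 0) (𝓝 (fluxHeat ε C t u)) := by
  simp only [h.quotient_heatCLM hε ht]
  refine tendsto_integral_filter_of_dominated_convergence
    (fun z => quotientBound ε K M D t * ‖u z‖) (Eventually.of_forall fun τ => ?_) ?_
    ((L1.integrable_coeFn u).norm.const_mul _) (Eventually.of_forall fun z => ?_)
  · exact (L1.integrable_coeFn u).aestronglyMeasurable.smul
      ((h.quotient τ).continuous.comp (continuous_heatKernelAt hε ht)).aestronglyMeasurable
  · filter_upwards [eventually_pos_le one_pos] with τ hτ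
    refine Eventually.of_forall fun z => ?_
    rw [norm_smul, mul_comm]
    gcongr
    exact h.norm_quotient_heatKernelAt_le hM hD hε ht hτ.1 hτ.2 z
  · exact (h.tendsto_quotient_heatKernelAt hM hD hε ht z).const_smul _

lemma IsBoundedSpeed.mass_fluxHeat (h : IsBoundedSpeed C K M D) (hM : 0 ≤ M) (hε : 0 < ε) {t : ℝ}
    (ht : 0 < t) (u : L1) : mass (fluxHeat ε C t u) = 0 := by
  rw [fluxHeat]
  by_cases hi : Integrable fun z => u z • toL1 (kernelFlux ε t C z)
  · rw [← ContinuousLinearMap.integral_comp_comm _ hi]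
    simp only [map_smul, mass_toL1 (h.integrable_kernelFlux hM hε ht _),
      h.integral_kernelFlux hε ht, smul_zero, integral_zero]
  -- Without integrability the Bochner integral is 0 by convention, so the claim still holds.
  · rw [integral_undef hi, map_zero]

/-- The operator `B (l - A)⁻¹`. -/
def fluxResolvent (ε : ℝ) (C : Plane → Plane) (l : ℝ) (u : L1) : L1 :=
  ∫ s in Set.Ioi (0 : ℝ), Real.exp (-(l * s)) • fluxHeat ε C s u

lemma IsBoundedSpeed.mass_fluxResolvent (h : IsBoundedSpeed C K M D) (hM : 0 ≤ M) (hε : 0 < ε)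
    (l : ℝ) (u : L1) : mass (fluxResolvent ε C l u) = 0 := by
  rw [fluxResolvent]
  by_cases hi : IntegrableOn (fun s : ℝ => Real.exp (-(l * s)) • fluxHeat ε C s u) (Set.Ioi 0)
  · rw [← ContinuousLinearMap.integral_comp_comm _ hi]
    refine (setIntegral_congr_fun measurableSet_Ioi fun s (hs : 0 < s) => ?_).trans
      (integral_zero _ _)
    simp only [map_smul, h.mass_fluxHeat hM hε hs, smul_zero]
  · rw [integral_undef hi, map_zero]

/-- A rescaled value of the Gamma function: Γ(1/2) = √π. -/
lemma integral_exp_div_sqrt {l : ℝ} (hl : 0 < l) :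
    ∫ s in Set.Ioi (0 : ℝ), Real.exp (-(l * s)) / √s = √Real.pi / √l := by
  have h1 := Real.integral_rpow_mul_exp_neg_mul_Ioi (a := 1 / 2) (r := l) (by norm_num) hl
  rw [Real.Gamma_one_half_eq, ← Real.sqrt_eq_rpow, Real.sqrt_div zero_le_one, Real.sqrt_one] at h1
  calc _ = ∫ s in Set.Ioi (0 : ℝ), s ^ ((1 / 2 : ℝ) - 1) * Real.exp (-(l * s)) := by
        refine setIntegral_congr_fun measurableSet_Ioi fun s (hs : 0 < s) => ?_
        have h2 : ((1 / 2 : ℝ) - 1) = -(1 / 2) := by norm_num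
        rw [h2, Real.rpow_neg hs.le, ← Real.sqrt_eq_rpow, div_eq_inv_mul]
    _ = _ := by rw [h1]; ring

lemma integrableOn_exp_div_sqrt {l : ℝ} (hl : 0 < l) :
    IntegrableOn (fun s : ℝ => Real.exp (-(l * s)) / √s) (Set.Ioi 0) := by
  refine .of_integral_ne_zero ?_
  rw [integral_exp_div_sqrt hl]
  have := Real.pi_pos
  positivity

lemma integrableOn_exp_neg_mul {l : ℝ} (hl : 0 < l) :
    IntegrableOn (fun s : ℝ => Real.exp (-(l * s))) (Set.Ioi 0) := by
  simpa only [neg_mul] using exp_neg_integrableOn_Ioi 0 hl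

lemma exp_mul_quotientBound (ε : ℝ) (K : ℝ≥0) (M D l : ℝ) :
    (fun s => Real.exp (-(l * s)) * quotientBound ε K M D s) = fun s =>
      regularCoeff ε M D * Real.exp (-(l * s)) +
        singularCoeff ε K M D * (Real.exp (-(l * s)) / √s) := by
  ext s
  rw [quotientBound]
  ring

lemma integrableOn_exp_mul_quotientBound {l : ℝ} (hl : 0 < l) (ε : ℝ) (K : ℝ≥0) (M D : ℝ) :
    IntegrableOn (fun s => Real.exp (-(l * s)) * quotientBound ε K M D s) (Set.Ioi 0) := by
  rw [exp_mul_quotientBound]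
  exact ((integrableOn_exp_neg_mul hl).const_mul _).add
    ((integrableOn_exp_div_sqrt hl).const_mul _)

lemma integral_exp_mul_quotientBound {l : ℝ} (hl : 0 < l) (ε : ℝ) (K : ℝ≥0) (M D : ℝ) :
    ∫ s in Set.Ioi 0, Real.exp (-(l * s)) * quotientBound ε K M D s =
      regularCoeff ε M D / l + singularCoeff ε K M D * √Real.pi / √l := by
  rw [exp_mul_quotientBound, integral_add ((integrableOn_exp_neg_mul hl).const_mul _)
    ((integrableOn_exp_div_sqrt hl).const_mul _), integral_const_mul, integral_const_mul,
    integral_exp_div_sqrt hl]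
  have h1 : ∫ s in Set.Ioi (0 : ℝ), Real.exp (-(l * s)) = 1 / l := by
    simpa [neg_mul, neg_div_neg_eq] using integral_exp_mul_Ioi (a := -l) (by linarith) 0
  rw [h1]
  ring

/-- Beyond this value the relative bound is at most `1/2`. -/
def resolventThreshold (ε : ℝ) (K : ℝ≥0) (M D : ℝ) : ℝ :=
  4 * regularCoeff ε M D + (4 * (singularCoeff ε K M D * √Real.pi)) ^ 2

lemma resolventThreshold_nonneg (hD : 0 ≤ D) : 0 ≤ resolventThreshold ε K M D :=
  add_nonneg (mul_nonneg (by norm_num) (regularCoeff_nonneg hD)) (sq_nonneg _)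

lemma integral_exp_mul_quotientBound_le (hD : 0 ≤ D) {l : ℝ}
    (hl : resolventThreshold ε K M D < l) :
    ∫ s in Set.Ioi 0, Real.exp (-(l * s)) * quotientBound ε K M D s ≤ 1 / 2 := by
  have h0 : 0 < l := (resolventThreshold_nonneg hD).trans_lt hl
  rw [integral_exp_mul_quotientBound h0]
  rw [resolventThreshold] at hl
  have h1 := regularCoeff_nonneg (ε := ε) (M := M) hD
  -- Each summand of the threshold brings one of the two terms below 1/4.
  have h2 : regularCoeff ε M D / l ≤ 1 / 4 := by
    rw [div_le_iff₀ h0]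
    nlinarith [sq_nonneg (4 * (singularCoeff ε K M D * √Real.pi))]
  have h3 : singularCoeff ε K M D * √Real.pi / √l ≤ 1 / 4 := by
    rw [div_le_iff₀ (Real.sqrt_pos.2 h0)]
    have h4 : 4 * (singularCoeff ε K M D * √Real.pi) ≤ √l := Real.le_sqrt_of_sq_le (by linarith)
    linarith
  linarith

lemma IsBoundedSpeed.quotient_laplace (h : IsBoundedSpeed C K M D) (hε : 0 < ε) {l : ℝ}
    (hl : 0 < l) (τ : ℝ≥0) (u : L1) :
    h.quotient τ (IsC0Semigroup.laplace (heatCLM hε) l u) =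
      ∫ s in Set.Ioi (0 : ℝ), Real.exp (-(l * s)) • h.quotient τ (heatCLM hε s.toNNReal u) := by
  rw [IsC0Semigroup.laplace, ← ContinuousLinearMap.integral_comp_comm _
    ((isC0Semigroup_heatCLM hε).integrableOn_laplace (norm_heatCLM_le hε) hl u)]
  simp only [map_smul]

lemma IsBoundedSpeed.norm_exp_smul_quotient_le (h : IsBoundedSpeed C K M D) (hM : 0 ≤ M)
    (hD : 0 ≤ D) (hε : 0 < ε) (l : ℝ) {s : ℝ} (hs : 0 < s) {τ : ℝ≥0} (hτ0 : 0 < τ) (hτ1 : τ ≤ 1)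
    (u : L1) : ‖Real.exp (-(l * s)) • h.quotient τ (heatCLM hε s.toNNReal u)‖ ≤
      Real.exp (-(l * s)) * quotientBound ε K M D s * ‖u‖ := by
  rw [norm_smul, Real.norm_eq_abs, Real.abs_exp, mul_assoc]
  have h1 := h.norm_quotient_heatCLM_le hM hD hε (Real.toNNReal_pos.2 hs) hτ0 hτ1 u
  rw [Real.coe_toNNReal s hs.le] at h1
  gcongr

/-- The majorant exp(-ls)(a + b/√s)‖u‖ is integrable and independent of τ, so the limit τ → 0 passes
inside the Laplace transform. The resolvent is thereby put in D(B) without appeal to closedness of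
B. -/
lemma IsBoundedSpeed.tendsto_quotient_laplace (h : IsBoundedSpeed C K M D) (hM : 0 ≤ M)
    (hD : 0 ≤ D) (hε : 0 < ε) {l : ℝ} (hl : 0 < l) (u : L1) :
    Tendsto (fun τ => h.quotient τ (IsC0Semigroup.laplace (heatCLM hε) l u)) (𝓝[>] 0)
      (𝓝 (fluxResolvent ε C l u)) := by
  simp only [h.quotient_laplace hε hl]
  refine tendsto_integral_filter_of_dominated_convergence
    (fun s => Real.exp (-(l * s)) * quotientBound ε K M D s * ‖u‖)
    (Eventually.of_forall fun τ => ?_) ?_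
    ((integrableOn_exp_mul_quotientBound hl ε K M D).mul_const _)
    (ae_restrict_of_forall_mem measurableSet_Ioi fun s (hs : 0 < s) => ?_)
  · exact ((by fun_prop : Continuous fun s : ℝ => Real.exp (-(l * s))).smul
      ((h.quotient τ).continuous.comp
        ((isC0Semigroup_heatCLM hε).continuous_orbit u))).aestronglyMeasurable
  · filter_upwards [eventually_pos_le one_pos] with τ hτ
    exact ae_restrict_of_forall_mem measurableSet_Ioi fun s hs =>
      h.norm_exp_smul_quotient_le hM hD hε l hs hτ.1 hτ.2 u
  · have h1 := h.tendsto_quotient_heatCLM hM hD hε (Real.toNNReal_pos.2 hs) u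
    rw [Real.coe_toNNReal s hs.le] at h1
    exact h1.const_smul _

/-- Every difference quotient with τ ≤ 1 has norm at most ‖u‖/2 beyond the threshold, and the bound
survives the limit. -/
lemma IsBoundedSpeed.isHalfBounded (h : IsBoundedSpeed C K M D) (hM : 0 ≤ M) (hD : 0 ≤ D)
    (hε : 0 < ε) {l : ℝ} (hl : resolventThreshold ε K M D < l) :
    IsHalfBounded (heatCLM hε) (generator fun t u => h.transportCLM t u) l
      (fluxResolvent ε C l) := by
  intro u
  have h0 : 0 < l := (resolventThreshold_nonneg hD).trans_lt hl
  have hlim := h.tendsto_quotient_laplace hM hD hε h0 u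
  refine ⟨hlim, le_of_tendsto hlim.norm ?_⟩
  filter_upwards [eventually_pos_le one_pos] with τ hτ
  rw [h.quotient_laplace hε h0]
  refine (norm_integral_le_of_norm_le
    ((integrableOn_exp_mul_quotientBound h0 ε K M D).mul_const ‖u‖)
    (ae_restrict_of_forall_mem measurableSet_Ioi fun s hs =>
      h.norm_exp_smul_quotient_le hM hD hε l hs hτ.1 hτ.2 u)).trans ?_
  rw [integral_mul_const]
  gcongr
  exact integral_exp_mul_quotientBound_le hD hl

end RelativeBound

end ConvectionDiffusion

end

/-! ### Assembly of the main theorem. -/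

theorem theorem3p14 (ε : ℝ) (hε : 0 < ε)
    (C : ConvectionDiffusion.Plane → ConvectionDiffusion.Plane)
    (hC : ConvectionDiffusion.IsAdmissibleSpeed C) :
    ConvectionDiffusion.domain (ConvectionDiffusion.diffusionOp ε) ⊆
        ConvectionDiffusion.domain (ConvectionDiffusion.convectionOp C) ∧
      ∃ T : ℝ≥0 → ConvectionDiffusion.L1 →L[ℝ] ConvectionDiffusion.L1,
        ConvectionDiffusion.IsC0Semigroup T ∧
        ConvectionDiffusion.generator (fun t u => T t u) =
          ConvectionDiffusion.opSum (ConvectionDiffusion.diffusionOp ε)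
            (ConvectionDiffusion.convectionOp C) ∧
        ∀ v₀ : ConvectionDiffusion.L1, 0 ≤ v₀ →
          (∀ v : ℝ≥0 → ConvectionDiffusion.L1,
            ConvectionDiffusion.IsMildSolution
              (ConvectionDiffusion.opSum (ConvectionDiffusion.diffusionOp ε)
                (ConvectionDiffusion.convectionOp C)) v₀ v ↔
              v = fun t => T t v₀) ∧
          ∀ t : ℝ≥0,
            (∫ x : ConvectionDiffusion.Plane, T t v₀ x) =
              ∫ x : ConvectionDiffusion.Plane, v₀ x := by
  obtain ⟨K, M, D, hM, hD, h⟩ := hC.exists_bounds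
  rw [ConvectionDiffusion.diffusionOp_eq hε, h.convectionOp_eq]
  -- The perturbation theorem is applied with growth rate ω = D + 2K for transport and P l = B(l -
  -- A)⁻¹.
  obtain ⟨hdom, T, hT, hgen, hmild, hmass⟩ := ConvectionDiffusion.exists_semigroup_opSum
    (ConvectionDiffusion.isC0Semigroup_heatCLM hε) (ConvectionDiffusion.norm_heatCLM_le hε)
    h.norm_transportCLM_le (ConvectionDiffusion.resolventThreshold_nonneg hD)
    fun l hl => h.isHalfBounded hM hD hε hl
  refine ⟨hdom, T, hT, hgen, fun v₀ _ => ⟨hmild v₀, fun t => ?_⟩⟩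
  rw [← ConvectionDiffusion.mass_apply, ← ConvectionDiffusion.mass_apply]
  exact hmass ConvectionDiffusion.mass (ConvectionDiffusion.mass_heatCLM hε)
    (fun l _ u => h.mass_fluxResolvent hM hε l u) t v₀
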